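/- For $x\in\mathbb R$ let $\psi(x)=x$ if $|x|\le 1$ and $\psi(x)=\operatorname{sign}(x)$ if $|x|>1$. Let $\|\cdot\|$ denote the Euclidean norm of vectors and the operator norm of matrices, and for a covariance matrix $\Sigma$ let $\mathbf r(\Sigma)=\operatorname{tr}(\Sigma)/\|\Sigma\|$ be its effective rank. There is an absolute constant $C>0$ such that the following holds for all $d\ge 0$, $N\ge 1$, $\eta\in[0,1]$ and $\delta\in(0,1)$. Let $X$ be a zero-mean random vector in $\mathbb R^d$ with finite second moments and covariance matrix $\Sigma$, satisfying the $L_4$–$L_2$ norm equivalence with a function $\kappa(\cdot)$: for all $v\in\mathbb R^d$ and all $2\le q\le 4$, $$(\mathbb E|\langle X,v\rangle|^q)^{1/q}\le \kappa(q)\,(\mathbb E|\langle X,v\rangle|^2)^{1/2},$$ and write $\kappa=\kappa(4)$. Let $X_1,\dots,X_N$ be independent copies of $X$, and let $\widetilde X_1,\dots,\widetilde X_N$ be an $\eta$-corrupted sample: almost surely $\widetilde X_i\ne X_i$ for at most $\eta N$ indices $i$, the replaced points being arbitrary vectors which may depend on $X_1,\dots,X_N$. Put $$\lambda=\frac1{\kappa^2\|\Sigma\|}\sqrt{\frac{\mathbf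 r(\Sigma)+\log(1/\delta)+\eta N}{N}},$$ and let $\Gamma=\Gamma(\widetilde X_1,\dots,\widetilde X_N)$ be the set of all positive semidefinite $A\in\mathbb R^{d\times d}$ such that $$\Bigl|\frac1{\lambda N}\sum_{i=1}^N\psi\bigl(\lambda\langle\widetilde X_i,v\rangle^2\bigr)-v^\top Av\Bigr|\le \frac{C\lambda\kappa^4\|\Sigma\|^2}{2}\qquad\text{for all } v\in\mathbb R^d \text{ with } \|v\|=1 .$$ Let $\widehat\Sigma_{\eta,\delta}$ be any estimator which, as a function of the data and of the known quantities $\eta,\delta,\kappa,\operatorname{tr}(\Sigma),\|\Sigma\|$, outputs some matrix in $\Gamma$ if $\Gamma\neq\emptyset$, and the matrix $0$ if $\Gamma=\emptyset$; such an estimator exists. Then, with probability at least $1-\delta$, $$\bigl\|\widehat\Sigma_{\eta,\delta}-\Sigma\bigr\|\le C\kappa^2\|\Sigma\|\left(\sqrt{\frac{\mathbf r(\Sigma)+\log(1/\delta)}{N}}+\sqrt{\eta}\right).$$ (In the degenerate case $\Sigma=0$ quotients with denominator $0$ are read as $0$, so that $\Gamma=\{0\}$. If the exceptional event is not measurable,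 the claim is that its outer probability is at most $\delta$.) -/

import Mathlib

open MeasureTheory ProbabilityTheory
open scoped Matrix Matrix.Norms.L2Operator

namespace RobustCov

/-- Vectors of `ℝ^d`, with the Euclidean norm and inner product. -/
abbrev Vec (d : ℕ) : Type := EuclideanSpace ℝ (Fin d)

/-- Real `d × d` matrices. The norm `‖A‖` of a matrix is, throughout, its operator norm with
respect to the Euclidean norm (scope `Matrix.Norms.L2Operator`). -/
abbrev Mat (d : ℕ) : Type := Matrix (Fin d) (Fin d) ℝ

/-- The truncation function: `ψ x = x` on `[-1, 1]` and `ψ x = sign x` elsewhere. -/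
noncomputable def psi (x : ℝ) : ℝ :=
  if x ∈ Set.Icc (-1 : ℝ) 1 then x else Real.sign x

/-- The covariance matrix of a random vector. -/
noncomputable def covMatrix {Ω : Type*} [MeasurableSpace Ω] {d : ℕ}
    (X : Ω → Vec d) (P : Measure Ω) : Mat d :=
  Matrix.of fun i j => cov[fun ω => X ω i, fun ω => X ω j; P]

/-- The effective rank as a function of the trace `t` and the operator norm `s` of the covariance
matrix. -/
noncomputable def effRank (t s : ℝ) : ℝ := t / s

/-- `L_p`-`L_2` norm equivalence with the function `κ`: for all `v` and all `2 ≤ q ≤ p`,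
`(E |⟨X, v⟩| ^ q) ^ (1 / q) ≤ κ q * (E |⟨X, v⟩| ^ 2) ^ (1 / 2)`. The norms take values in `[0, ∞]`,
so that finiteness of the moments of order `q` is part of the condition whenever the second moments
are finite. -/
def NormEquivalence {Ω : Type*} [MeasurableSpace Ω] {d : ℕ}
    (X : Ω → Vec d) (P : Measure Ω) (p : ℝ) (κ : ℝ → ℝ) : Prop :=
  ∀ (v : Vec d) (q : ℝ), 2 ≤ q → q ≤ p →
    eLpNorm (fun ω => inner ℝ (X ω) v) (ENNReal.ofReal q) P
      ≤ ENNReal.ofReal (κ q) * eLpNorm (fun ω => inner ℝ (X ω) v) 2 P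

/-- `X 0, …, X (N - 1)` is a sample of independent copies of `X₀`. -/
structure IsSample {Ω : Type*} [MeasurableSpace Ω] {d N : ℕ}
    (X : Fin N → Ω → Vec d) (X₀ : Ω → Vec d) (P : Measure Ω) : Prop where
  indep : iIndepFun X P
  copies : ∀ i, IdentDistrib (X i) X₀ P P

/-- `X'` is an `η`-corruption of the sample `X`: almost surely at most `η * N` of the points have
been replaced. The replacements are otherwise arbitrary: they may depend on the whole sample, on
further randomness, and need not even be measurable. -/
def IsCorrupted {Ω : Type*} [MeasurableSpace Ω] {d N : ℕ}
    (η : ℝ) (X' X : Fin N → Ω → Vec d) (P : Measure Ω) : Prop :=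
  ∀ᵐ ω ∂P, (Nat.card {i : Fin N // X' i ω ≠ X i ω} : ℝ) ≤ η * N

/-- The truncation level `λ`, from the sample size `N`, the corruption level `η`, the confidence
level `δ`, the constant `k = κ(4)`, and the trace `t` and operator norm `s` of the covariance
matrix. -/
noncomputable def truncLevel (N : ℕ) (η δ k t s : ℝ) : ℝ :=
  1 / (k ^ 2 * s) * √((effRank t s + Real.log (1 / δ) + η * N) / N)

/-- The truncated empirical quadratic form of the data points `x` in the direction `v`. -/
noncomputable def truncForm {d N : ℕ} (lam : ℝ) (x : Fin N → Vec d) (v : Vec d) : ℝ :=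
  1 / (lam * N) * ∑ i, psi (lam * (inner ℝ (x i) v) ^ 2)

/-- The set `Γ` of positive semidefinite matrices whose quadratic forms are, uniformly over the unit
sphere, within `C λ k ^ 4 s ^ 2 / 2` of the truncated empirical quadratic forms of the data. -/
def feasibleSet {d N : ℕ} (C η δ k t s : ℝ) (x : Fin N → Vec d) : Set (Mat d) :=
  {A | A.PosSemidef ∧ ∀ v : Vec d, ‖v‖ = 1 →
    |truncForm (truncLevel N η δ k t s) x v - v.ofLp ⬝ᵥ (A *ᵥ v.ofLp)|
      ≤ C * truncLevel N η δ k t s * k ^ 4 * s ^ 2 / 2}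

/-- `est`, a function of the data, outputs some matrix of the set `Γ` if `Γ` is non-empty, and the
matrix `0` otherwise. -/
def IsTruncEstimator {d N : ℕ} (C η δ k t s : ℝ) (est : (Fin N → Vec d) → Mat d) : Prop :=
  ∀ x : Fin N → Vec d,
    ((feasibleSet C η δ k t s x).Nonempty → est x ∈ feasibleSet C η δ k t s x) ∧
    (feasibleSet C η δ k t s x = ∅ → est x = 0)

end RobustCov

/-!
Write `Σ` for the covariance matrix, `r` for its effective rank, `s` for its operator norm and
`λ` for the truncation level. The choice of `λ` means that `λ² k⁴ s² = L / N`, where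
`L = r + log (1 / δ) + η N`.

**Reduction.** If `Σ` lies in the feasible set, so does the output of the estimator, and two
feasible matrices differ in operator norm by at most `C λ k⁴ s²`, which is the claimed bound
(`norm_sub_le_of_mem_feasibleSet`, `truncLevel_mul_pow_le`). Replacing `η N` points changes
`∑ ψ (λ ⟨X_i, v⟩²)` by at most `η N ≤ L`, because `ψ` takes values in `[0, 1]` on `[0, ∞)`. It
therefore suffices that, for the uncorrupted sample and with probability at least `1 - δ`,
`|∑ ψ (λ ⟨X_i, v⟩²) - N λ vᵀΣv| ≲ L` for all unit vectors `v` simultaneously.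

**Uniformity over the sphere.** This comes from a PAC-Bayesian inequality (`pac_bayes`). If
`E exp (g (X, θ)) ≤ exp (m θ)` for every `θ`, then `∑ g (X_i, θ) - N m θ` has exponential moment at
most one for every `θ`, hence on average over a Gaussian `θ`. By Markov's inequality this Gaussian
average is at most `1 / ε` outside an event of probability `ε`. Off that event the Cameron-Martin
formula and Jensen's inequality (`exp_integral_shift_le`) bound
`∑ E_ξ g (X_i, v + σ ξ) - N E_ξ m (v + σ ξ)` by `‖v‖² / (2 σ²) + log (1 / ε)` for all `v` at once.

**The functions to which it is applied.** Let `Z (x, θ) = λ (⟨x, θ⟩² - σ² ‖x‖²)`, whose average over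
`θ = v + σ ξ` is `λ ⟨x, v⟩²`, and let `T` be the quartic form `quarticForm`, which dominates `Z²`
pointwise and on Gaussian average. The inequality is used for `g = ψ (Z)`, `g = -ψ (Z)` and
`g = min 1 T`; elementary inequalities give `exp g ≤ 1 ± Z + 2 T` and `exp g ≤ 1 + 2 T`.
The difference between `ψ (E_ξ Z)` and `E_ξ ψ (Z)` is at most `2 min 1 (T (x, v))`
(`abs_psi_sub_integral_psi_le`), since `|ψ z - z| ≤ z²` and `|ψ| ≤ 1`. This is in turn at most
`4 E_ξ min 1 (T (x, v + σ ξ))` by the symmetry of `ξ` (`min_one_quarticForm_le`), which the third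
instance controls.

**Order of the terms.** With `σ² = 1 / r` the entropy `1 / (2 σ²)` is `r / 2`, and the norm
equivalence gives `E ⟨X, v⟩⁴ ≤ k⁴ s²` and `σ⁴ E ‖X‖⁴ ≤ k⁴ (tr Σ)² / r² = k⁴ s²`, so that the
averages of `T` contribute a multiple of `N λ² k⁴ s² = L`. The term `log (3 / δ)` is of the order
of `L` as `r ≥ 1`.
-/

namespace RobustCov

open Real

/-! ### The standard Gaussian measure: density, translations and moments -/

theorem integrable_exp_neg_half_sq_norm (d : ℕ) :
    Integrable (fun x : Vec d => exp (-‖x‖ ^ 2 / 2)) := by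
  have h := (GaussianFourier.integrable_cexp_neg_mul_sq_norm_add (V := Vec d)
    (b := (1 / 2 : ℂ)) (by norm_num) 0 0).norm
  refine h.congr (Filter.Eventually.of_forall fun x => ?_)
  simp only [Complex.norm_exp]
  congr 1
  simp
  norm_cast
  ring_nf

/-- The Lebesgue density of the standard Gaussian measure, up to normalization; both sides have the
same characteristic function. -/
theorem stdGaussian_eq_tilted (d : ℕ) :
    stdGaussian (Vec d) = (volume : Measure (Vec d)).tilted (fun x => -‖x‖ ^ 2 / 2) := by
  have hint := integrable_exp_neg_half_sq_norm d
  have := isProbabilityMeasure_tilted hint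
  apply Measure.ext_of_charFun
  ext t
  rw [charFun_stdGaussian, charFun_apply, integral_tilted]
  have h0 : ((∫ x : Vec d, exp (-‖x‖ ^ 2 / 2) : ℝ) : ℂ)
      = (π / (1 / 2 : ℂ)) ^ (Module.finrank ℝ (Vec d) / 2 : ℂ) := by
    rw [← GaussianFourier.integral_cexp_neg_mul_sq_norm (V := Vec d)
      (b := (1 / 2 : ℂ)) (by norm_num), ← integral_complex_ofReal]
    congr 1
    ext x
    push_cast
    ring_nf
  have h1 := GaussianFourier.integral_cexp_neg_mul_sq_norm_add (V := Vec d)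
      (b := (1 / 2 : ℂ)) (by norm_num) Complex.I t
  rw [← h0] at h1
  have hne : ((∫ x : Vec d, exp (-‖x‖ ^ 2 / 2) : ℝ) : ℂ) ≠ 0 := by
    exact_mod_cast (integral_exp_pos hint).ne'
  have h2 : ∀ x : Vec d, (exp (-‖x‖ ^ 2 / 2) / ∫ x : Vec d, exp (-‖x‖ ^ 2 / 2)) •
      Complex.exp (inner ℝ x t * Complex.I)
      = ((∫ x : Vec d, exp (-‖x‖ ^ 2 / 2) : ℝ) : ℂ)⁻¹ *
        Complex.exp (-(1 / 2) * ‖x‖ ^ 2 + Complex.I * inner ℝ t x) := by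
    intro x
    rw [Complex.real_smul, Complex.exp_add, real_inner_comm]
    push_cast
    ring_nf
  simp_rw [h2]
  rw [integral_const_mul, h1, inv_mul_cancel_left₀ hne]
  congr 1
  simp
  ring

/-- The standard Gaussian measure is quasi-invariant under the translation by `w`, with the density
of Cameron and Martin. -/
theorem integral_stdGaussian_eq_shift {d : ℕ} (w : Vec d) (f : Vec d → ℝ) :
    ∫ x, f x ∂stdGaussian (Vec d)
      = ∫ x, exp (-inner ℝ w x - ‖w‖ ^ 2 / 2) * f (w + x) ∂stdGaussian (Vec d) := by
  rw [stdGaussian_eq_tilted, integral_tilted, integral_tilted,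
    ← integral_add_left_eq_self _ w]
  congr 1
  ext x
  have h : exp (-‖w + x‖ ^ 2 / 2) = exp (-‖x‖ ^ 2 / 2) * exp (-inner ℝ w x - ‖w‖ ^ 2 / 2) := by
    rw [norm_add_sq_real, ← exp_add]
    ring_nf
  rw [h, smul_eq_mul, smul_eq_mul]
  ring

theorem integrable_stdGaussian_iff_shift {d : ℕ} (w : Vec d) (f : Vec d → ℝ) :
    Integrable f (stdGaussian (Vec d)) ↔
      Integrable (fun x => exp (-inner ℝ w x - ‖w‖ ^ 2 / 2) * f (w + x)) (stdGaussian (Vec d)) := by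
  have hint := integrable_exp_neg_half_sq_norm d
  rw [stdGaussian_eq_tilted, integrable_tilted_iff hint, integrable_tilted_iff hint,
    ← (measurePreserving_add_left volume w).integrable_comp_emb (measurableEmbedding_addLeft w)]
  refine integrable_congr (Filter.Eventually.of_forall fun x => ?_)
  simp only [Function.comp_def]
  rw [norm_add_sq_real, smul_eq_mul, smul_eq_mul, ← mul_assoc, ← exp_add]
  ring_nf

theorem map_inner_stdGaussian {d : ℕ} (x : Vec d) :
    (stdGaussian (Vec d)).map (fun ξ => inner ℝ x ξ)
      = (gaussianReal 0 1).map (fun y => ‖x‖ * y) := by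
  have h := IsGaussian.map_eq_gaussianReal (μ := stdGaussian (Vec d)) (innerSL ℝ x)
  rw [integral_strongDual_stdGaussian, variance_dual_stdGaussian, innerSL_apply_norm] at h
  rw [gaussianReal_map_const_mul]
  convert! h using 2
  · simp
  · ext
    simp

theorem integrable_pow_gaussianReal (n : ℕ) :
    Integrable (fun y : ℝ => y ^ n) (gaussianReal 0 1) := by
  have h := (memLp_id_gaussianReal (μ := 0) (v := 1) n).integrable_norm_pow'
  simp only [id] at h
  refine h.mono' (by fun_prop) (Filter.Eventually.of_forall fun y => ?_)
  simp

theorem integral_sq_gaussianReal : ∫ y, y ^ 2 ∂gaussianReal 0 1 = 1 := by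
  have h := variance_fun_id_gaussianReal (μ := 0) (v := 1)
  rw [variance_eq_integral (by fun_prop)] at h
  simpa using h

theorem integral_cube_gaussianReal : ∫ y, y ^ 3 ∂gaussianReal 0 1 = 0 := by
  have h : ∫ y, y ^ 3 ∂gaussianReal 0 1 = ∫ y, (-y) ^ 3 ∂gaussianReal 0 1 := by
    conv_lhs => rw [← neg_zero, ← gaussianReal_map_neg]
    rw [integral_map (by fun_prop) (by fun_prop)]
  have h2 : ∫ y : ℝ, (-y) ^ 3 ∂gaussianReal 0 1 = - ∫ y, y ^ 3 ∂gaussianReal 0 1 := by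
    rw [← integral_neg]
    congr 1
    ext y
    ring
  linarith

/-- The exact value is `3`; the crude bound comes from `y ^ 4 ≤ 24 (exp y + exp (-y))`. -/
theorem integral_pow_four_gaussianReal_le : ∫ y, y ^ 4 ∂gaussianReal 0 1 ≤ 96 := by
  have hm : ∀ t : ℝ, ∫ y, exp (t * y) ∂gaussianReal 0 1 = exp (t ^ 2 / 2) := fun t => by
    have := congrFun (mgf_fun_id_gaussianReal (μ := 0) (v := 1)) t
    simpa [mgf] using this
  have hi : ∀ t : ℝ, Integrable (fun y => exp (t * y)) (gaussianReal 0 1) :=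
    fun t => integrable_exp_mul_gaussianReal t
  have key : ∀ y : ℝ, y ^ 4 ≤ 24 * (exp (1 * y) + exp (-1 * y)) := by
    intro y
    rcases le_total 0 y with h | h
    · have := pow_div_factorial_le_exp y h 4
      have h2 := exp_pos (-1 * y)
      norm_num [Nat.factorial] at this ⊢
      norm_num at h2
      linarith
    · have := pow_div_factorial_le_exp (-y) (by linarith) 4
      have h2 := exp_pos (1 * y)
      norm_num [Nat.factorial] at this ⊢
      norm_num at h2
      linarith
  calc ∫ y, y ^ 4 ∂gaussianReal 0 1
      ≤ ∫ y, 24 * (exp (1 * y) + exp (-1 * y)) ∂gaussianReal 0 1 :=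
        integral_mono (integrable_pow_gaussianReal 4) (((hi 1).add (hi (-1))).const_mul 24) key
    _ = 24 * (exp (1 / 2) + exp (1 / 2)) := by
        rw [integral_const_mul, integral_add (hi 1) (hi (-1)), hm, hm]
        norm_num
    _ ≤ 96 := by
        have h1 : exp (1 / 2) ^ 2 = exp 1 := by rw [← exp_nat_mul]; norm_num
        have h2 := exp_one_lt_d9
        have h3 := exp_pos (1 / 2 : ℝ)
        nlinarith

theorem integral_inner_stdGaussian {d : ℕ} (x : Vec d) {f : ℝ → ℝ} (hf : Continuous f) :
    ∫ ξ, f (inner ℝ x ξ) ∂stdGaussian (Vec d) = ∫ y, f (‖x‖ * y) ∂gaussianReal 0 1 := by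
  rw [← integral_map (φ := fun ξ => inner ℝ x ξ) (by fun_prop) (by fun_prop),
    map_inner_stdGaussian, integral_map (by fun_prop) (by fun_prop)]

theorem integrable_inner_pow_stdGaussian {d : ℕ} (x : Vec d) (n : ℕ) :
    Integrable (fun ξ => (inner ℝ x ξ : ℝ) ^ n) (stdGaussian (Vec d)) := by
  have h : Integrable (fun y : ℝ => y ^ n) ((stdGaussian (Vec d)).map (fun ξ => inner ℝ x ξ)) := by
    rw [map_inner_stdGaussian, integrable_map_measure (by fun_prop) (by fun_prop)]
    simp only [Function.comp_def, mul_pow]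
    exact (integrable_pow_gaussianReal n).const_mul _
  rwa [integrable_map_measure (by fun_prop) (by fun_prop)] at h

theorem integral_inner_stdGaussian_one {d : ℕ} (x : Vec d) :
    ∫ ξ, (inner ℝ x ξ : ℝ) ∂stdGaussian (Vec d) = 0 := by
  rw [integral_inner_stdGaussian x (f := fun y => y) (by fun_prop), integral_const_mul]
  simp

theorem integral_inner_stdGaussian_two {d : ℕ} (x : Vec d) :
    ∫ ξ, (inner ℝ x ξ : ℝ) ^ 2 ∂stdGaussian (Vec d) = ‖x‖ ^ 2 := by
  rw [integral_inner_stdGaussian x (f := fun y => y ^ 2) (by fun_prop)]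
  simp_rw [mul_pow]
  rw [integral_const_mul, integral_sq_gaussianReal, mul_one]

theorem integral_inner_stdGaussian_three {d : ℕ} (x : Vec d) :
    ∫ ξ, (inner ℝ x ξ : ℝ) ^ 3 ∂stdGaussian (Vec d) = 0 := by
  rw [integral_inner_stdGaussian x (f := fun y => y ^ 3) (by fun_prop)]
  simp_rw [mul_pow]
  rw [integral_const_mul, integral_cube_gaussianReal, mul_zero]

theorem integral_inner_stdGaussian_four_le {d : ℕ} (x : Vec d) :
    ∫ ξ, (inner ℝ x ξ : ℝ) ^ 4 ∂stdGaussian (Vec d) ≤ 96 * ‖x‖ ^ 4 := by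
  rw [integral_inner_stdGaussian x (f := fun y => y ^ 4) (by fun_prop)]
  simp_rw [mul_pow]
  rw [integral_const_mul, mul_comm]
  exact mul_le_mul_of_nonneg_right integral_pow_four_gaussianReal_le (by positivity)

theorem map_neg_stdGaussian (d : ℕ) :
    (stdGaussian (Vec d)).map (fun ξ => -ξ) = stdGaussian (Vec d) :=
  stdGaussian_map (LinearIsometryEquiv.neg ℝ (E := Vec d))

theorem integrable_norm_pow_stdGaussian (d n : ℕ) :
    Integrable (fun ξ => ‖ξ‖ ^ n) (stdGaussian (Vec d)) :=
  (IsGaussian.memLp_id (stdGaussian (Vec d)) n (by simp)).integrable_norm_pow'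

/-- The change of measure behind the PAC-Bayesian bound: the relative entropy of the standard
Gaussian centred at `w` with respect to the one centred at `0` is `‖w‖ ^ 2 / 2`. -/
theorem exp_integral_shift_le {d : ℕ} (w : Vec d) {F : Vec d → ℝ}
    (hF : Integrable (fun ξ => F (w + ξ)) (stdGaussian (Vec d)))
    (hexp : Integrable (fun ξ => exp (F ξ)) (stdGaussian (Vec d))) :
    exp (∫ ξ, F (w + ξ) ∂stdGaussian (Vec d) - ‖w‖ ^ 2 / 2)
      ≤ ∫ ξ, exp (F ξ) ∂stdGaussian (Vec d) := by
  have hw := integrable_inner_pow_stdGaussian w 1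
  simp only [pow_one] at hw
  have hexp' := (integrable_stdGaussian_iff_shift w _).1 hexp
  rw [integral_stdGaussian_eq_shift w (fun ξ => exp (F ξ))]
  simp_rw [← exp_add] at hexp' ⊢
  have hY : Integrable (fun ξ => -inner ℝ w ξ - ‖w‖ ^ 2 / 2 + F (w + ξ)) (stdGaussian (Vec d)) :=
    (hw.neg.sub (integrable_const _)).add hF
  have hI : ∫ ξ, (-inner ℝ w ξ - ‖w‖ ^ 2 / 2 + F (w + ξ)) ∂stdGaussian (Vec d)
      = ∫ ξ, F (w + ξ) ∂stdGaussian (Vec d) - ‖w‖ ^ 2 / 2 := by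
    have h1 := integral_add (hw.neg.sub (integrable_const (‖w‖ ^ 2 / 2))) hF
    have h2 := integral_sub hw.neg (integrable_const (‖w‖ ^ 2 / 2))
    simp only [Pi.sub_apply, Pi.neg_apply] at h1 h2
    rw [h1, h2, integral_neg, integral_inner_stdGaussian_one]
    simp
    ring
  rw [← hI]
  exact convexOn_exp.map_integral_le continuousOn_exp isClosed_univ (by simp) hY hexp'

/-! ### The PAC-Bayesian inequality -/

theorem integral_exp_sum_sub_le_one {α : Type*} [MeasurableSpace α] {ν : Measure α}
    [IsProbabilityMeasure ν] {f : α → ℝ} {m : ℝ} (h : ∫ x, exp (f x) ∂ν ≤ exp m) (N : ℕ) :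
    ∫ x, exp (∑ i, f (x i) - N * m) ∂(Measure.pi fun _ : Fin N => ν) ≤ 1 := by
  have h1 : ∀ x : Fin N → α, exp (∑ i, f (x i) - N * m) = ∏ i, (exp (f (x i)) * exp (-m)) := by
    intro x
    rw [Finset.prod_mul_distrib, ← exp_sum, Finset.prod_const, ← exp_nat_mul, ← exp_add]
    simp [sub_eq_add_neg]
  simp_rw [h1]
  rw [integral_fintype_prod_eq_pow (fun x => exp (f x) * exp (-m)), integral_mul_const]
  refine pow_le_one₀ (by positivity) ?_
  calc _ ≤ exp m * exp (-m) := by gcongr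
    _ = 1 := by rw [← exp_add]; simp

/-- **PAC-Bayesian bound** with Gaussian prior and posteriors. Outside an event of probability at
most `ε`, the inequality holds for all centres `w` of the posterior simultaneously. -/
theorem pac_bayes {α : Type*} [MeasurableSpace α] (ν : Measure α) [IsProbabilityMeasure ν]
    {d : ℕ} (N : ℕ) {g : α → Vec d → ℝ} (hg : Measurable (Function.uncurry g))
    (hb : ∀ x θ, |g x θ| ≤ 1) {m : Vec d → ℝ} (hm : Measurable m)
    (hgm : ∀ θ, ∫ x, exp (g x θ) ∂ν ≤ exp (m θ))
    (hmi : ∀ w, Integrable (fun ξ => m (w + ξ)) (stdGaussian (Vec d))) {ε : ℝ} (hε : 0 < ε) :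
    ∃ B : Set (Fin N → α), MeasurableSet B ∧
      Measure.pi (fun _ : Fin N => ν) B ≤ ENNReal.ofReal ε ∧
      ∀ x ∉ B, ∀ w : Vec d, ∑ i, ∫ ξ, g (x i) (w + ξ) ∂stdGaussian (Vec d)
        ≤ N * ∫ ξ, m (w + ξ) ∂stdGaussian (Vec d) + ‖w‖ ^ 2 / 2 + log (1 / ε) := by
  set F : (Fin N → α) → Vec d → ℝ := fun x θ => ∑ i, g (x i) θ - N * m θ with hF
  have hgc : ∀ i : Fin N, Measurable fun p : (Fin N → α) × Vec d => g (p.1 i) p.2 := fun i => by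
    have h : Measurable fun p : (Fin N → α) × Vec d => (p.1 i, p.2) := by fun_prop
    exact hg.comp h
  have hFm : Measurable (Function.uncurry F) := by
    refine (Finset.measurable_sum _ fun i _ => hgc i).sub ?_
    exact (hm.comp measurable_snd).const_mul _
  have hgx : ∀ x : α, Measurable (g x) := fun x => hg.comp measurable_prodMk_left
  have hEm : Measurable fun p : (Fin N → α) × Vec d => ENNReal.ofReal (exp (F p.1 p.2)) :=
    (measurable_exp.comp hFm).ennreal_ofReal
  set G : (Fin N → α) → ENNReal :=
    fun x => ∫⁻ θ, ENNReal.ofReal (exp (F x θ)) ∂stdGaussian (Vec d) with hG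
  have hGm : Measurable G := hEm.lintegral_prod_right'
  have hsum : ∀ (x : Fin N → α) θ, |∑ i : Fin N, g (x i) θ| ≤ N := fun x θ => by
    refine (Finset.abs_sum_le_sum_abs _ _).trans ?_
    exact (Finset.sum_le_sum fun i _ => hb (x i) θ).trans (by simp)
  have hG1 : ∫⁻ x, G x ∂(Measure.pi fun _ : Fin N => ν) ≤ 1 := by
    rw [hG, lintegral_lintegral_swap hEm.aemeasurable]
    have : ∀ θ, ∫⁻ x, ENNReal.ofReal (exp (F x θ)) ∂(Measure.pi fun _ : Fin N => ν) ≤ 1 := by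
      intro θ
      rw [← ofReal_integral_eq_lintegral_ofReal]
      · exact ENNReal.ofReal_le_one.2 (integral_exp_sum_sub_le_one (hgm θ) N)
      · refine Integrable.of_bound (C := exp (N - N * m θ)) ?_ ?_
        · exact ((measurable_exp.comp (hFm.comp measurable_prodMk_right))).aestronglyMeasurable
        · refine Filter.Eventually.of_forall fun x => ?_
          rw [norm_of_nonneg (exp_pos _).le]
          exact exp_le_exp.2 (sub_le_sub_right ((le_abs_self _).trans (hsum x θ)) _)
      · exact Filter.Eventually.of_forall fun x => (exp_pos _).le
    exact (lintegral_mono this).trans (by simp)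
  -- The exceptional event only involves the average over the prior, so it does not depend on `w`.
  refine ⟨{x | ENNReal.ofReal (1 / ε) ≤ G x}, measurableSet_le measurable_const hGm, ?_, ?_⟩
  · have h := (mul_meas_ge_le_lintegral (μ := Measure.pi fun _ : Fin N => ν) hGm
      (ENNReal.ofReal (1 / ε))).trans hG1
    calc _ = ENNReal.ofReal ε * (ENNReal.ofReal (1 / ε) *
          Measure.pi (fun _ : Fin N => ν) {x | ENNReal.ofReal (1 / ε) ≤ G x}) := by
          rw [← mul_assoc, ← ENNReal.ofReal_mul hε.le, mul_one_div_cancel hε.ne']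
          simp
      _ ≤ ENNReal.ofReal ε * 1 := by gcongr
      _ = _ := mul_one _
  · intro x hx w
    simp only [Set.mem_ofPred_eq, not_le] at hx
    have hFx : Measurable (F x) := hFm.comp measurable_prodMk_left
    have hexp : Integrable (fun ξ => exp (F x ξ)) (stdGaussian (Vec d)) := by
      refine ⟨(measurable_exp.comp hFx).aestronglyMeasurable, ?_⟩
      rw [hasFiniteIntegral_iff_ofReal (Filter.Eventually.of_forall fun _ => (exp_pos _).le)]
      exact hx.trans ENNReal.ofReal_lt_top
    have hgi : ∀ i, Integrable (fun ξ => g (x i) (w + ξ)) (stdGaussian (Vec d)) := fun i =>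
      Integrable.of_bound (C := 1)
        ((hgx (x i)).comp (measurable_const_add w)).aestronglyMeasurable
        (Filter.Eventually.of_forall fun ξ => hb _ _)
    have hs := integrable_finsetSum Finset.univ fun i _ => hgi i
    have hFi : Integrable (fun ξ => F x (w + ξ)) (stdGaussian (Vec d)) :=
      hs.sub ((hmi w).const_mul _)
    have hle := exp_integral_shift_le w hFi hexp
    have hlt : ∫ ξ, exp (F x ξ) ∂stdGaussian (Vec d) < 1 / ε := by
      rw [integral_eq_lintegral_of_nonneg_ae (Filter.Eventually.of_forall fun _ => (exp_pos _).le)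
        hexp.1]
      exact (ENNReal.toReal_lt_of_lt_ofReal hx)
    have hlog := (le_log_iff_exp_le (by positivity)).2 (hle.trans hlt.le)
    have hIF : ∫ ξ, F x (w + ξ) ∂stdGaussian (Vec d)
        = ∑ i, ∫ ξ, g (x i) (w + ξ) ∂stdGaussian (Vec d)
          - N * ∫ ξ, m (w + ξ) ∂stdGaussian (Vec d) := by
      rw [← integral_finsetSum _ fun i _ => hgi i, ← integral_const_mul]
      exact integral_sub hs ((hmi w).const_mul _)
    rw [hIF] at hlog
    linarith

/-- Integrability for the joint law of a data point and a posterior draw, from growth of order four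
in both variables. -/
theorem integrable_prod_of_abs_le {d : ℕ} {ν : Measure (Vec d)} [IsProbabilityMeasure ν]
    (h4 : Integrable (fun x => ‖x‖ ^ 4) ν) {f : Vec d → Vec d → ℝ}
    (hf : Measurable (Function.uncurry f)) {K : ℝ}
    (hK : ∀ x θ, |f x θ| ≤ K * ((1 + ‖x‖ ^ 4) * (1 + ‖θ‖ ^ 4))) (v : Vec d) (σ : ℝ) :
    Integrable (fun p : Vec d × Vec d => f p.1 (v + σ • p.2)) (ν.prod (stdGaussian (Vec d))) := by
  have hθ : Integrable (fun ξ => 1 + ‖v + σ • ξ‖ ^ 4) (stdGaussian (Vec d)) := by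
    refine (integrable_const 1).add ?_
    refine (((integrable_const (‖v‖ ^ 4)).add
      ((integrable_norm_pow_stdGaussian d 4).const_mul (σ ^ 4))).const_mul 8).mono'
      (by fun_prop) (Filter.Eventually.of_forall fun ξ => ?_)
    rw [norm_of_nonneg (by positivity)]
    have h1 : ‖v + σ • ξ‖ ^ 4 ≤ (‖v‖ + ‖σ • ξ‖) ^ 4 :=
      pow_le_pow_left₀ (norm_nonneg _) (norm_add_le _ _) 4
    have h2 := add_pow_le (norm_nonneg v) (norm_nonneg (σ • ξ)) 4
    have h3 : ‖σ • ξ‖ ^ 4 = σ ^ 4 * ‖ξ‖ ^ 4 := by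
      rw [norm_smul, mul_pow, Real.norm_eq_abs, ← abs_pow, abs_of_nonneg (by positivity)]
    rw [h3] at h2
    norm_num at h2
    exact h1.trans h2
  have hx : Integrable (fun x => 1 + ‖x‖ ^ 4) ν := (integrable_const 1).add h4
  refine ((hx.mul_prod hθ).const_mul K).mono' ?_ (Filter.Eventually.of_forall fun p => hK _ _)
  have h : Measurable fun p : Vec d × Vec d => (p.1, v + σ • p.2) := by fun_prop
  exact (hf.comp h).aestronglyMeasurable

/-- The PAC-Bayesian bound with posteriors `v + σ • ξ`, under the one-sided moment condition
`exp g ≤ 1 + q`. -/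
theorem pac_bayes_of_exp_le {d : ℕ} (ν : Measure (Vec d)) [IsProbabilityMeasure ν]
    (h4 : Integrable (fun x => ‖x‖ ^ 4) ν) (N : ℕ) {g q : Vec d → Vec d → ℝ}
    (hg : Measurable (Function.uncurry g)) (hb : ∀ x θ, |g x θ| ≤ 1)
    (hq : Measurable (Function.uncurry q)) {K : ℝ}
    (hK : ∀ x θ, |q x θ| ≤ K * ((1 + ‖x‖ ^ 4) * (1 + ‖θ‖ ^ 4)))
    (hgq : ∀ x θ, exp (g x θ) ≤ 1 + q x θ) {σ : ℝ} (hσ : 0 < σ) {ε : ℝ} (hε : 0 < ε) :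
    ∃ B : Set (Fin N → Vec d), MeasurableSet B ∧
      Measure.pi (fun _ : Fin N => ν) B ≤ ENNReal.ofReal ε ∧
      ∀ x ∉ B, ∀ v : Vec d, ∑ i, ∫ ξ, g (x i) (v + σ • ξ) ∂stdGaussian (Vec d)
        ≤ N * ∫ x, ∫ ξ, q x (v + σ • ξ) ∂stdGaussian (Vec d) ∂ν
          + ‖v‖ ^ 2 / (2 * σ ^ 2) + log (1 / ε) := by
  have hqi : ∀ θ, Integrable (fun x => q x θ) ν := by
    intro θ
    refine ((((integrable_const 1).add h4).mul_const (1 + ‖θ‖ ^ 4)).const_mul K).mono'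
      (hq.comp measurable_prodMk_right).aestronglyMeasurable
      (Filter.Eventually.of_forall fun x => hK x θ)
  have hsm : Measurable fun p : Vec d × Vec d => (p.1, σ • p.2) := by fun_prop
  have hqsw : Measurable fun p : Vec d × Vec d => q p.2 p.1 := hq.comp measurable_swap
  have hmm : Measurable fun θ => ∫ x, q x θ ∂ν :=
    (hqsw.stronglyMeasurable.integral_prod_right' (ν := ν)).measurable
  have hprod := integrable_prod_of_abs_le h4 hq hK
  have hscale : ∀ w ξ : Vec d, σ • (w + ξ) = σ • w + σ • ξ := fun w ξ => smul_add σ w ξ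
  obtain ⟨B, hBm, hB, hBx⟩ := pac_bayes ν N (g := fun x θ => g x (σ • θ)) (hg.comp hsm)
    (fun x θ => hb _ _) (m := fun θ => ∫ x, q x (σ • θ) ∂ν)
    (hmm.comp (measurable_const_smul σ))
    (fun θ => by
      have h1 : ∫ x, exp (g x (σ • θ)) ∂ν ≤ ∫ x, (1 + q x (σ • θ)) ∂ν := by
        refine integral_mono ?_ ((integrable_const 1).add (hqi _)) fun x => hgq _ _
        refine Integrable.of_bound (C := exp 1)
          (measurable_exp.comp (hg.comp measurable_prodMk_right)).aestronglyMeasurable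
          (Filter.Eventually.of_forall fun x => ?_)
        rw [norm_of_nonneg (exp_pos _).le]
        exact exp_le_exp.2 ((le_abs_self _).trans (hb _ _))
      rw [integral_add (integrable_const 1) (hqi _)] at h1
      simp only [integral_const, probReal_univ, smul_eq_mul, mul_one] at h1
      rw [add_comm] at h1
      exact h1.trans (add_one_le_exp _))
    (fun w => by
      simp_rw [hscale]
      exact (hprod (σ • w) σ).integral_prod_right) hε
  refine ⟨B, hBm, hB, fun x hx v => ?_⟩
  -- In the rescaled parameter the posterior `v + σ • ξ` has centre `σ⁻¹ • v`.
  have h := hBx x hx (σ⁻¹ • v)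
  have hv : ∀ ξ : Vec d, σ • (σ⁻¹ • v + ξ) = v + σ • ξ := fun ξ => by
    rw [hscale, smul_inv_smul₀ hσ.ne']
  simp_rw [hv] at h
  rw [integral_integral_swap (hprod v σ)]
  convert h using 3
  rw [norm_smul, norm_inv, Real.norm_eq_abs, abs_of_pos hσ]
  field_simp

/-! ### Truncation and Gaussian averages of quadratic and quartic forms -/

theorem psi_eq_max_min (x : ℝ) : psi x = max (-1) (min 1 x) := by
  unfold psi
  split_ifs with h
  · rw [min_eq_right h.2, max_eq_right h.1]
  · rw [Set.mem_Icc, not_and_or, not_le, not_le] at h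
    rcases h with h | h
    · rw [Real.sign_of_neg (by linarith), min_eq_right (by linarith), max_eq_left h.le]
    · rw [Real.sign_of_pos (by linarith), min_eq_left h.le, max_eq_right (by norm_num)]

theorem continuous_psi : Continuous psi := by
  rw [funext psi_eq_max_min]
  fun_prop

theorem abs_psi_le_one (x : ℝ) : |psi x| ≤ 1 := by
  rw [psi_eq_max_min, abs_le]
  exact ⟨le_max_left _ _, max_le (by norm_num) (min_le_left _ _)⟩

theorem psi_nonneg {x : ℝ} (hx : 0 ≤ x) : 0 ≤ psi x := by
  rw [psi_eq_max_min]
  exact le_max_of_le_right (le_min zero_le_one hx)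

theorem abs_psi_sub_self_le (x : ℝ) : |psi x - x| ≤ x ^ 2 := by
  rw [psi_eq_max_min]
  rcases le_total x 1 with h | h <;> rcases le_total (-1) x with h' | h' <;>
    simp only [min_eq_right, min_eq_left, max_eq_right, max_eq_left, h, h',
      show (-1 : ℝ) ≤ 1 by norm_num] <;> rw [abs_le] <;> constructor <;> nlinarith

theorem exp_le_of_abs_le_one {y : ℝ} (hy : |y| ≤ 1) : exp y ≤ 1 + y + y ^ 2 := by
  have h := abs_exp_sub_one_sub_id_le hy
  linarith [(abs_le.1 h).2]

theorem sq_psi_le (x : ℝ) : psi x ^ 2 ≤ x ^ 2 := by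
  rw [psi_eq_max_min, sq_le_sq]
  rcases le_total x 1 with h | h <;> rcases le_total (-1) x with h' | h' <;>
    simp only [min_eq_right, min_eq_left, max_eq_right, max_eq_left, h, h',
      show (-1 : ℝ) ≤ 1 by norm_num] <;> simp <;> rw [le_abs] <;>
      first | (left; linarith) | (right; linarith)

/-- The exponential moment bound for `± ψ`: a bounded variable is compared with its own first two
moments. -/
theorem exp_mul_psi_le {s : ℝ} (hs : |s| ≤ 1) (z : ℝ) :
    exp (s * psi z) ≤ 1 + (s * z + 2 * z ^ 2) := by
  have h1 : |s * psi z| ≤ 1 := by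
    rw [abs_mul]
    exact mul_le_one₀ hs (abs_nonneg _) (abs_psi_le_one z)
  have h2 := exp_le_of_abs_le_one h1
  have h3 : s * psi z - s * z ≤ z ^ 2 := by
    rw [← mul_sub]
    refine (le_abs_self _).trans ?_
    rw [abs_mul]
    calc |s| * |psi z - z| ≤ 1 * z ^ 2 := by
          gcongr
          exact abs_psi_sub_self_le z
      _ = z ^ 2 := one_mul _
  have h4 : (s * psi z) ^ 2 ≤ z ^ 2 := by
    rw [mul_pow]
    calc s ^ 2 * psi z ^ 2 ≤ 1 * z ^ 2 :=
          mul_le_mul ((sq_le_one_iff_abs_le_one s).2 hs) (sq_psi_le z) (sq_nonneg _) zero_le_one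
      _ = z ^ 2 := one_mul _
  linarith

theorem exp_min_one_le {t : ℝ} (ht : 0 ≤ t) : exp (min 1 t) ≤ 1 + 2 * t := by
  have h0 : 0 ≤ min 1 t := le_min zero_le_one ht
  have h1 : min 1 t ≤ 1 := min_le_left _ _
  have h2 := exp_le_of_abs_le_one (y := min 1 t) (by rw [abs_of_nonneg h0]; exact h1)
  have h3 : min 1 t ≤ t := min_le_right _ _
  nlinarith

/-- The quadratic form `lam * ⟨x, θ⟩ ^ 2`, corrected so that its mean under the Gaussian law of `θ`
with mean `v` and covariance `σ ^ 2` is `lam * ⟨x, v⟩ ^ 2`. -/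
noncomputable def centredForm {d : ℕ} (lam σ : ℝ) (x θ : Vec d) : ℝ :=
  lam * ((inner ℝ x θ) ^ 2 - σ ^ 2 * ‖x‖ ^ 2)

/-- A quartic form which dominates `centredForm ^ 2`, both pointwise and, with the posterior centre
as the argument, in Gaussian mean. -/
noncomputable def quarticForm {d : ℕ} (lam σ : ℝ) (x θ : Vec d) : ℝ :=
  lam ^ 2 * (3 * (inner ℝ x θ) ^ 4 + 100 * (σ ^ 4 * ‖x‖ ^ 4))

theorem continuous_centredForm (d : ℕ) (lam σ : ℝ) :
    Continuous fun p : Vec d × Vec d => centredForm lam σ p.1 p.2 := by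
  unfold centredForm
  fun_prop

theorem continuous_quarticForm (d : ℕ) (lam σ : ℝ) :
    Continuous fun p : Vec d × Vec d => quarticForm lam σ p.1 p.2 := by
  unfold quarticForm
  fun_prop

theorem quarticForm_nonneg {d : ℕ} (lam σ : ℝ) (x θ : Vec d) : 0 ≤ quarticForm lam σ x θ := by
  unfold quarticForm
  positivity

theorem centredForm_sq_le {d : ℕ} (lam σ : ℝ) (x θ : Vec d) :
    centredForm lam σ x θ ^ 2 ≤ quarticForm lam σ x θ := by
  unfold centredForm quarticForm
  rw [mul_pow]
  refine mul_le_mul_of_nonneg_left ?_ (sq_nonneg _)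
  nlinarith [sq_nonneg ((inner ℝ x θ) ^ 2 + σ ^ 2 * ‖x‖ ^ 2), sq_nonneg ((inner ℝ x θ : ℝ) ^ 2),
    sq_nonneg (σ ^ 2 * ‖x‖ ^ 2)]

theorem quarticForm_le {d : ℕ} (lam σ : ℝ) (x θ : Vec d) :
    quarticForm lam σ x θ
      ≤ lam ^ 2 * (3 + 100 * σ ^ 4) * ((1 + ‖x‖ ^ 4) * (1 + ‖θ‖ ^ 4)) := by
  unfold quarticForm
  rw [mul_assoc]
  refine mul_le_mul_of_nonneg_left ?_ (sq_nonneg _)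
  have h1 : (inner ℝ x θ : ℝ) ^ 4 ≤ ‖x‖ ^ 4 * ‖θ‖ ^ 4 := by
    rw [← mul_pow, ← Even.pow_abs (by decide : Even 4)]
    exact pow_le_pow_left₀ (abs_nonneg _) (abs_real_inner_le_norm x θ) 4
  have hx : 0 ≤ ‖x‖ ^ 4 := by positivity
  have hθ : 0 ≤ ‖θ‖ ^ 4 := by positivity
  have hs : 0 ≤ σ ^ 4 := by positivity
  have hxθ := mul_nonneg hx hθ
  nlinarith [mul_nonneg hs hx, mul_nonneg hs hxθ, mul_nonneg hs hθ]

section GaussianMoments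

variable {d : ℕ} (lam σ : ℝ) (x v : Vec d)

theorem inner_add_smul (ξ : Vec d) :
    (inner ℝ x (v + σ • ξ) : ℝ) = inner ℝ x v + inner ℝ (σ • x) ξ := by
  rw [inner_add_right, real_inner_smul_right, real_inner_smul_left]

theorem norm_smul_sq : ‖σ • x‖ ^ 2 = σ ^ 2 * ‖x‖ ^ 2 := by
  rw [norm_smul, mul_pow, Real.norm_eq_abs, sq_abs]

/-- Gaussian expectation of a quartic polynomial in one linear form. -/
theorem integral_quartic_stdGaussian (a : Vec d) (c₀ c₁ c₂ c₃ c₄ : ℝ) :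
    ∫ ξ, (c₀ + c₁ * inner ℝ a ξ + c₂ * (inner ℝ a ξ) ^ 2 + c₃ * (inner ℝ a ξ) ^ 3
        + c₄ * (inner ℝ a ξ) ^ 4) ∂stdGaussian (Vec d)
      = c₀ + c₂ * ‖a‖ ^ 2 + c₄ * ∫ ξ, (inner ℝ a ξ) ^ 4 ∂stdGaussian (Vec d) := by
  have i1 := (integrable_inner_pow_stdGaussian a 1).const_mul c₁
  have i2 := (integrable_inner_pow_stdGaussian a 2).const_mul c₂
  have i3 := (integrable_inner_pow_stdGaussian a 3).const_mul c₃
  have i4 := (integrable_inner_pow_stdGaussian a 4).const_mul c₄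
  simp only [pow_one] at i1
  have i0 := integrable_const (μ := stdGaussian (Vec d)) c₀
  rw [integral_add (by fun_prop) i4, integral_add (by fun_prop) i3, integral_add (by fun_prop) i2,
    integral_add i0 i1]
  simp only [integral_const_mul, integral_inner_stdGaussian_one, integral_inner_stdGaussian_two,
    integral_inner_stdGaussian_three]
  simp

theorem integral_centredForm :
    ∫ ξ, centredForm lam σ x (v + σ • ξ) ∂stdGaussian (Vec d) = lam * (inner ℝ x v) ^ 2 := by
  have h := integral_quartic_stdGaussian (σ • x)
    (lam * ((inner ℝ x v) ^ 2 - σ ^ 2 * ‖x‖ ^ 2)) (2 * lam * inner ℝ x v) lam 0 0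
  calc _ = _ := by
        refine integral_congr_ae (Filter.Eventually.of_forall fun ξ => ?_)
        simp only [centredForm, inner_add_smul]
        ring
    _ = _ := h
    _ = _ := by
        rw [norm_smul_sq]
        ring

theorem integral_centredForm_sq_le :
    ∫ ξ, centredForm lam σ x (v + σ • ξ) ^ 2 ∂stdGaussian (Vec d) ≤ quarticForm lam σ x v := by
  set y : ℝ := inner ℝ x v with hy
  set u : ℝ := σ ^ 2 * ‖x‖ ^ 2 with hu
  have h := integral_quartic_stdGaussian (σ • x)
    (lam ^ 2 * (y ^ 2 - u) ^ 2) (lam ^ 2 * (4 * y * (y ^ 2 - u)))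
    (lam ^ 2 * (4 * y ^ 2 + 2 * (y ^ 2 - u))) (lam ^ 2 * (4 * y)) (lam ^ 2)
  have h4 := integral_inner_stdGaussian_four_le (σ • x)
  have hn4 : ‖σ • x‖ ^ 4 = u ^ 2 := by
    rw [show ‖σ • x‖ ^ 4 = (‖σ • x‖ ^ 2) ^ 2 by ring, norm_smul_sq]
  calc _ = _ := by
        refine integral_congr_ae (Filter.Eventually.of_forall fun ξ => ?_)
        simp only [centredForm, inner_add_smul, ← hy, ← hu]
        ring
    _ = _ := h
    _ ≤ lam ^ 2 * (y ^ 2 - u) ^ 2 + lam ^ 2 * (4 * y ^ 2 + 2 * (y ^ 2 - u)) * u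
          + lam ^ 2 * (96 * u ^ 2) := by
        rw [norm_smul_sq, ← hu]
        rw [hn4] at h4
        gcongr
    _ ≤ lam ^ 2 * (3 * y ^ 4 + 100 * u ^ 2) := by
        rw [mul_assoc, ← mul_add, ← mul_add]
        refine mul_le_mul_of_nonneg_left ?_ (sq_nonneg _)
        nlinarith [sq_nonneg (y ^ 2 - u), sq_nonneg u]
    _ = _ := by
        rw [quarticForm, ← hy, hu]
        ring

theorem integral_quarticForm_le :
    ∫ ξ, quarticForm lam σ x (v + σ • ξ) ∂stdGaussian (Vec d)
      ≤ lam ^ 2 * (12 * (inner ℝ x v) ^ 4 + 400 * (σ ^ 4 * ‖x‖ ^ 4)) := by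
  set y : ℝ := inner ℝ x v with hy
  set u : ℝ := σ ^ 2 * ‖x‖ ^ 2 with hu
  have h := integral_quartic_stdGaussian (σ • x)
    (lam ^ 2 * (3 * y ^ 4 + 100 * u ^ 2)) (lam ^ 2 * (12 * y ^ 3))
    (lam ^ 2 * (18 * y ^ 2)) (lam ^ 2 * (12 * y)) (lam ^ 2 * 3)
  have h4 := integral_inner_stdGaussian_four_le (σ • x)
  have hn4 : ‖σ • x‖ ^ 4 = u ^ 2 := by
    rw [show ‖σ • x‖ ^ 4 = (‖σ • x‖ ^ 2) ^ 2 by ring, norm_smul_sq]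
  calc _ = _ := by
        refine integral_congr_ae (Filter.Eventually.of_forall fun ξ => ?_)
        simp only [quarticForm, inner_add_smul, ← hy, hu]
        ring
    _ = _ := h
    _ ≤ lam ^ 2 * (3 * y ^ 4 + 100 * u ^ 2) + lam ^ 2 * (18 * y ^ 2) * u
          + lam ^ 2 * 3 * (96 * u ^ 2) := by
        rw [norm_smul_sq, ← hu]
        rw [hn4] at h4
        gcongr
    _ = lam ^ 2 * (3 * y ^ 4 + 18 * y ^ 2 * u + 388 * u ^ 2) := by ring
    _ ≤ lam ^ 2 * (12 * y ^ 4 + 400 * u ^ 2) := by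
        refine mul_le_mul_of_nonneg_left ?_ (sq_nonneg _)
        nlinarith [sq_nonneg (y ^ 2 - u), sq_nonneg u]
    _ = _ := by
        rw [hu]
        ring

/-- Truncation commutes with the Gaussian average up to a truncated second moment. -/
theorem abs_psi_sub_integral_psi_le :
    |psi (lam * (inner ℝ x v) ^ 2)
        - ∫ ξ, psi (centredForm lam σ x (v + σ • ξ)) ∂stdGaussian (Vec d)|
      ≤ 2 * min 1 (quarticForm lam σ x v) := by
  set Z : Vec d → ℝ := fun ξ => centredForm lam σ x (v + σ • ξ) with hZ
  have hZc : Continuous Z := by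
    have := continuous_centredForm d lam σ
    exact this.comp (f := fun ξ => (x, v + σ • ξ)) (by fun_prop)
  have hψi : Integrable (fun ξ => psi (Z ξ)) (stdGaussian (Vec d)) :=
    Integrable.of_bound (C := 1) (continuous_psi.comp hZc).aestronglyMeasurable
      (Filter.Eventually.of_forall fun ξ => abs_psi_le_one _)
  have hZ2 : Integrable (fun ξ => Z ξ ^ 2) (stdGaussian (Vec d)) := by
    have hq := integrable_prod_of_abs_le (ν := Measure.dirac x) (f := quarticForm lam σ)
      (integrable_dirac (by finiteness)) (continuous_quarticForm d lam σ).measurable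
      (fun x θ => by
        rw [abs_of_nonneg (quarticForm_nonneg lam σ x θ)]
        exact quarticForm_le lam σ x θ) v σ
    have hq' := hq.prod_right_ae
    rw [ae_dirac_eq] at hq'
    refine Integrable.mono' hq' (hZc.pow 2).aestronglyMeasurable
      (Filter.Eventually.of_forall fun ξ => ?_)
    rw [norm_of_nonneg (sq_nonneg _)]
    exact centredForm_sq_le lam σ x _
  have hZi : Integrable Z (stdGaussian (Vec d)) := by
    refine ((integrable_const 1).add hZ2).mono' hZc.aestronglyMeasurable
      (Filter.Eventually.of_forall fun ξ => ?_)
    simp only [Pi.add_apply, Real.norm_eq_abs]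
    nlinarith [sq_nonneg (|Z ξ| - 1), sq_abs (Z ξ)]
  have hEZ : ∫ ξ, Z ξ ∂stdGaussian (Vec d) = lam * (inner ℝ x v) ^ 2 :=
    integral_centredForm lam σ x v
  have hEZ2 : ∫ ξ, Z ξ ^ 2 ∂stdGaussian (Vec d) ≤ quarticForm lam σ x v :=
    integral_centredForm_sq_le lam σ x v
  set w := lam * (inner ℝ x v : ℝ) ^ 2 with hw
  have hw2 : w ^ 2 ≤ quarticForm lam σ x v := by
    unfold quarticForm
    rw [hw, mul_pow]
    refine mul_le_mul_of_nonneg_left ?_ (sq_nonneg _)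
    have h1 : 0 ≤ (inner ℝ x v : ℝ) ^ 4 := by positivity
    have h2 : 0 ≤ σ ^ 4 * ‖x‖ ^ 4 := by positivity
    nlinarith
  have hψZ : |∫ ξ, psi (Z ξ) ∂stdGaussian (Vec d) - w| ≤ quarticForm lam σ x v := by
    rw [← hEZ, ← integral_sub hψi hZi]
    refine (abs_integral_le_integral_abs).trans (le_trans ?_ hEZ2)
    exact integral_mono (hψi.sub hZi).abs hZ2 fun ξ => abs_psi_sub_self_le _
  have hψ1 : |∫ ξ, psi (Z ξ) ∂stdGaussian (Vec d)| ≤ 1 := by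
    refine abs_integral_le_integral_abs.trans ?_
    refine (integral_mono hψi.abs (integrable_const 1) fun ξ => abs_psi_le_one _).trans ?_
    simp
  have hw1 := abs_psi_sub_self_le w
  have hw3 := abs_psi_le_one w
  rw [abs_le] at *
  rcases min_cases 1 (quarticForm lam σ x v) with ⟨h, _⟩ | ⟨h, _⟩ <;> rw [h] <;>
    constructor <;> linarith

theorem abs_le_abs_add_or_abs_sub (a b : ℝ) : |a| ≤ |a + b| ∨ |a| ≤ |a - b| := by
  by_contra! h
  have h1 := abs_add_le (a + b) (a - b)
  rw [show a + b + (a - b) = 2 * a by ring, abs_mul, abs_two] at h1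
  linarith

/-- Since `ξ` is symmetric, `|⟨x, v + σ • ξ⟩| ≥ |⟨x, v⟩|` with probability at least `1 / 2`. -/
theorem min_one_quarticForm_le :
    min 1 (quarticForm lam σ x v)
      ≤ 2 * ∫ ξ, min 1 (quarticForm lam σ x (v + σ • ξ)) ∂stdGaussian (Vec d) := by
  set T : Vec d → ℝ := fun θ => min 1 (quarticForm lam σ x θ) with hT
  have hTc : Continuous T := by
    have := (continuous_quarticForm d lam σ).comp (f := fun θ : Vec d => (x, θ)) (by fun_prop)
    exact continuous_const.min this
  have hTi : ∀ s : ℝ, Integrable (fun ξ => T (v + s • ξ)) (stdGaussian (Vec d)) := fun s =>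
    Integrable.of_bound (C := 1) (hTc.comp (by fun_prop)).aestronglyMeasurable
      (Filter.Eventually.of_forall fun ξ => by
        rw [norm_of_nonneg (le_min zero_le_one (quarticForm_nonneg _ _ _ _))]
        exact min_le_left _ _)
  have hsymm : ∫ ξ, T (v + σ • ξ) ∂stdGaussian (Vec d)
      = ∫ ξ, T (v + (-σ) • ξ) ∂stdGaussian (Vec d) := by
    conv_lhs => rw [← map_neg_stdGaussian]
    rw [integral_map (φ := fun ξ : Vec d => -ξ) (f := fun ξ => T (v + σ • ξ)) (by fun_prop)
      (hTc.comp (by fun_prop)).aestronglyMeasurable]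
    simp
  have hmono : ∀ θ : Vec d, |inner ℝ x v| ≤ |inner ℝ x θ| → T v ≤ T θ := by
    intro θ h
    refine min_le_min_left _ ?_
    have h4 := pow_le_pow_left₀ (abs_nonneg _) h 4
    rw [Even.pow_abs (by decide), Even.pow_abs (by decide)] at h4
    unfold quarticForm
    gcongr
  have hT0 : ∀ θ, 0 ≤ T θ := fun θ => le_min zero_le_one (quarticForm_nonneg _ _ _ _)
  -- One of `v + σ • ξ` and `v - σ • ξ` has the larger inner product with `x`.
  have hpt : ∀ ξ, T v ≤ T (v + σ • ξ) + T (v + (-σ) • ξ) := by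
    intro ξ
    have h1 : (inner ℝ x (v + σ • ξ) : ℝ) = inner ℝ x v + σ * inner ℝ x ξ := by
      rw [inner_add_right, real_inner_smul_right]
    have h2 : (inner ℝ x (v + (-σ) • ξ) : ℝ) = inner ℝ x v - σ * inner ℝ x ξ := by
      rw [inner_add_right, real_inner_smul_right]
      ring
    rcases abs_le_abs_add_or_abs_sub (inner ℝ x v) (σ * inner ℝ x ξ) with h | h
    · rw [← h1] at h
      linarith [hmono _ h, hT0 (v + (-σ) • ξ)]
    · rw [← h2] at h
      linarith [hmono _ h, hT0 (v + σ • ξ)]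
  have h := integral_mono (integrable_const (T v)) ((hTi σ).add (hTi (-σ))) hpt
  rw [integral_add' (hTi σ) (hTi (-σ)), ← hsymm] at h
  simp only [integral_const, probReal_univ, smul_eq_mul, one_mul] at h
  linarith

end GaussianMoments

/-! ### Uniform concentration of truncated quadratic forms -/

section Concentration

variable {d : ℕ} {ν : Measure (Vec d)}

theorem integrable_inner_pow_four (h4 : Integrable (fun x => ‖x‖ ^ 4) ν) (v : Vec d) :
    Integrable (fun x => (inner ℝ x v : ℝ) ^ 4) ν := by
  refine (h4.mul_const (‖v‖ ^ 4)).mono' (by fun_prop) (Filter.Eventually.of_forall fun x => ?_)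
  rw [norm_pow, ← mul_pow]
  exact pow_le_pow_left₀ (norm_nonneg _) (norm_inner_le_norm x v) 4

variable [IsProbabilityMeasure ν]

theorem integrable_inner_sq (h4 : Integrable (fun x => ‖x‖ ^ 4) ν) (v : Vec d) :
    Integrable (fun x => (inner ℝ x v : ℝ) ^ 2) ν := by
  refine ((integrable_const 1).add (integrable_inner_pow_four h4 v)).mono' (by fun_prop)
    (Filter.Eventually.of_forall fun x => ?_)
  rw [norm_of_nonneg (sq_nonneg _)]
  simp only [Pi.add_apply]
  nlinarith [sq_nonneg ((inner ℝ x v : ℝ) ^ 2 - 1)]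

theorem abs_add_quarticForm_le {s : ℝ} (hs : |s| ≤ 1) (lam σ : ℝ) (x θ : Vec d) :
    |s * centredForm lam σ x θ + 2 * quarticForm lam σ x θ|
      ≤ (1 + 3 * (lam ^ 2 * (3 + 100 * σ ^ 4))) * ((1 + ‖x‖ ^ 4) * (1 + ‖θ‖ ^ 4)) := by
  have h1 := centredForm_sq_le lam σ x θ
  have h2 := quarticForm_le lam σ x θ
  have h3 : |s * centredForm lam σ x θ| ≤ 1 + centredForm lam σ x θ ^ 2 := by
    rw [abs_mul]
    have : |s| * |centredForm lam σ x θ| ≤ 1 * |centredForm lam σ x θ| := by gcongr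
    nlinarith [sq_nonneg (|centredForm lam σ x θ| - 1), sq_abs (centredForm lam σ x θ)]
  have h4 : (1 : ℝ) ≤ (1 + ‖x‖ ^ 4) * (1 + ‖θ‖ ^ 4) := by
    have hx : 0 ≤ ‖x‖ ^ 4 := by positivity
    have hθ : 0 ≤ ‖θ‖ ^ 4 := by positivity
    nlinarith [mul_nonneg hx hθ]
  have h5 := quarticForm_nonneg lam σ x θ
  refine (abs_add_le _ _).trans ?_
  rw [abs_of_nonneg (by linarith : 0 ≤ 2 * quarticForm lam σ x θ)]
  linarith

/-- The mean, over the data point and over the posterior, of the majorant in the exponential moment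
condition. -/
theorem integral_integral_majorant_le (h4 : Integrable (fun x => ‖x‖ ^ 4) ν) {lam σ M : ℝ}
    {v : Vec d} (hM : ∫ x, (inner ℝ x v : ℝ) ^ 4 ∂ν ≤ M) (hM' : σ ^ 4 * ∫ x, ‖x‖ ^ 4 ∂ν ≤ M)
    {s : ℝ} (hs : |s| ≤ 1) :
    ∫ x, ∫ ξ, (s * centredForm lam σ x (v + σ • ξ) + 2 * quarticForm lam σ x (v + σ • ξ))
        ∂stdGaussian (Vec d) ∂ν
      ≤ s * (lam * ∫ x, (inner ℝ x v : ℝ) ^ 2 ∂ν) + 824 * lam ^ 2 * M := by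
  have hmZ := (continuous_centredForm d lam σ).measurable
  have hmT := (continuous_quarticForm d lam σ).measurable
  have hiT := integrable_prod_of_abs_le h4 (f := fun x θ => quarticForm lam σ x θ) hmT
    (fun x θ => by
      rw [abs_of_nonneg (quarticForm_nonneg lam σ x θ)]
      exact quarticForm_le lam σ x θ) v σ
  have hiq := integrable_prod_of_abs_le h4
    (f := fun x θ => s * centredForm lam σ x θ + 2 * quarticForm lam σ x θ)
    ((hmZ.const_mul s).add (hmT.const_mul 2)) (abs_add_quarticForm_le hs lam σ) v σ
  have hi2 := integrable_inner_sq h4 v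
  have hi4 := integrable_inner_pow_four h4 v
  have hle : ∀ᵐ x ∂ν, ∫ ξ, (s * centredForm lam σ x (v + σ • ξ)
        + 2 * quarticForm lam σ x (v + σ • ξ)) ∂stdGaussian (Vec d)
      ≤ s * (lam * (inner ℝ x v : ℝ) ^ 2)
        + 2 * (lam ^ 2 * (12 * (inner ℝ x v) ^ 4 + 400 * (σ ^ 4 * ‖x‖ ^ 4))) := by
    filter_upwards [hiT.prod_right_ae, hiq.prod_right_ae] with x hxT hxq
    have hxZ : Integrable (fun ξ => s * centredForm lam σ x (v + σ • ξ)) (stdGaussian (Vec d)) := by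
      refine (hxq.sub (hxT.const_mul 2)).congr (Filter.Eventually.of_forall fun ξ => ?_)
      simp
    rw [integral_add hxZ (hxT.const_mul 2), integral_const_mul, integral_const_mul,
      integral_centredForm]
    linarith [integral_quarticForm_le lam σ x v]
  have hiR : Integrable (fun x => 2 * (lam ^ 2 * (12 * (inner ℝ x v) ^ 4
      + 400 * (σ ^ 4 * ‖x‖ ^ 4)))) ν :=
    (((hi4.const_mul 12).add
      ((h4.const_mul (σ ^ 4)).const_mul 400)).const_mul (lam ^ 2)).const_mul 2
  refine (integral_mono_ae hiq.integral_prod_left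
    (((hi2.const_mul lam).const_mul s).add hiR) hle).trans ?_
  simp only [Pi.add_apply]
  rw [integral_add ((hi2.const_mul lam).const_mul s) hiR]
  simp only [integral_const_mul]
  rw [integral_add (hi4.const_mul 12) ((h4.const_mul (σ ^ 4)).const_mul 400)]
  simp only [integral_const_mul]
  have hl := sq_nonneg lam
  nlinarith [mul_le_mul_of_nonneg_left hM hl, mul_le_mul_of_nonneg_left hM' hl]

/-- Uniform concentration of the truncated quadratic forms. The three PAC-Bayesian bounds are for
the truncated forms, for their negatives, and for the truncated quartic form which controls the
error of passing from the posterior to its centre. -/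
theorem exists_sum_psi_sub_le (h4 : Integrable (fun x => ‖x‖ ^ 4) ν) (N : ℕ) {lam σ M δ : ℝ}
    (hσ : 0 < σ) (hδ : 0 < δ) (hM : ∀ v : Vec d, ‖v‖ = 1 → ∫ x, (inner ℝ x v : ℝ) ^ 4 ∂ν ≤ M)
    (hM' : σ ^ 4 * ∫ x, ‖x‖ ^ 4 ∂ν ≤ M) :
    ∃ B : Set (Fin N → Vec d), MeasurableSet B ∧
      Measure.pi (fun _ : Fin N => ν) B ≤ ENNReal.ofReal δ ∧
      ∀ x ∉ B, ∀ v : Vec d, ‖v‖ = 1 →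
        |∑ i, psi (lam * (inner ℝ (x i) v) ^ 2) - N * (lam * ∫ x, (inner ℝ x v : ℝ) ^ 2 ∂ν)|
          ≤ 5 * (824 * (N * (lam ^ 2 * M)) + 1 / (2 * σ ^ 2) + log (3 / δ)) := by
  have hmZ := (continuous_centredForm d lam σ).measurable
  have hmT := (continuous_quarticForm d lam σ).measurable
  have hmq : ∀ s : ℝ, Measurable (Function.uncurry fun x θ : Vec d =>
      s * centredForm lam σ x θ + 2 * quarticForm lam σ x θ) := fun s =>
    (hmZ.const_mul s).add (hmT.const_mul 2)
  have hψ : ∀ s : ℝ, |s| ≤ 1 → ∃ B : Set (Fin N → Vec d), MeasurableSet B ∧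
      Measure.pi (fun _ : Fin N => ν) B ≤ ENNReal.ofReal (δ / 3) ∧
      ∀ x ∉ B, ∀ v : Vec d,
        ∑ i, ∫ ξ, s * psi (centredForm lam σ (x i) (v + σ • ξ)) ∂stdGaussian (Vec d)
        ≤ N * ∫ x, ∫ ξ, (s * centredForm lam σ x (v + σ • ξ)
            + 2 * quarticForm lam σ x (v + σ • ξ)) ∂stdGaussian (Vec d) ∂ν
          + ‖v‖ ^ 2 / (2 * σ ^ 2) + log (1 / (δ / 3)) := fun s hs =>
    pac_bayes_of_exp_le ν h4 N (g := fun x θ => s * psi (centredForm lam σ x θ))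
      ((continuous_psi.measurable.comp hmZ).const_mul s)
      (fun x θ => by
        rw [abs_mul]
        exact mul_le_one₀ hs (abs_nonneg _) (abs_psi_le_one _))
      (hmq s) (abs_add_quarticForm_le hs lam σ)
      (fun x θ => by
        linarith [exp_mul_psi_le hs (centredForm lam σ x θ), centredForm_sq_le lam σ x θ])
      hσ (by positivity)
  obtain ⟨B₁, hB₁m, hB₁, h₁⟩ := hψ 1 (by simp)
  obtain ⟨B₂, hB₂m, hB₂, h₂⟩ := hψ (-1) (by simp)
  obtain ⟨B₃, hB₃m, hB₃, h₃⟩ := pac_bayes_of_exp_le ν h4 N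
    (g := fun x θ => min 1 (quarticForm lam σ x θ))
    (measurable_const.min hmT)
    (fun x θ => by
      rw [abs_of_nonneg (le_min zero_le_one (quarticForm_nonneg _ _ _ _))]
      exact min_le_left _ _)
    (hmq 0) (abs_add_quarticForm_le (by simp) lam σ)
    (fun x θ => by
      linarith [exp_min_one_le (quarticForm_nonneg lam σ x θ)])
    hσ (by positivity : 0 < δ / 3)
  refine ⟨B₁ ∪ B₂ ∪ B₃, (hB₁m.union hB₂m).union hB₃m, ?_, fun x hx v hv => ?_⟩
  · calc _ ≤ ENNReal.ofReal (δ / 3) + ENNReal.ofReal (δ / 3) + ENNReal.ofReal (δ / 3) := by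
          refine (measure_union_le _ _).trans (add_le_add ?_ hB₃)
          exact (measure_union_le _ _).trans (add_le_add hB₁ hB₂)
      _ = ENNReal.ofReal δ := by
          rw [← ENNReal.ofReal_add (by positivity) (by positivity),
            ← ENNReal.ofReal_add (by positivity) (by positivity)]
          ring_nf
  · simp only [Set.mem_union, not_or] at hx
    obtain ⟨⟨hx₁, hx₂⟩, hx₃⟩ := hx
    have e₁ := h₁ x hx₁ v
    have e₂ := h₂ x hx₂ v
    have e₃ := h₃ x hx₃ v
    have m₁ := integral_integral_majorant_le h4 (lam := lam) (hM v hv) hM' (s := 1) (by simp)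
    have m₂ := integral_integral_majorant_le h4 (lam := lam) (hM v hv) hM' (s := -1) (by simp)
    have m₃ := integral_integral_majorant_le h4 (lam := lam) (hM v hv) hM' (s := 0) (by simp)
    have hN : (0 : ℝ) ≤ N := Nat.cast_nonneg N
    replace m₁ := mul_le_mul_of_nonneg_left m₁ hN
    replace m₂ := mul_le_mul_of_nonneg_left m₂ hN
    replace m₃ := mul_le_mul_of_nonneg_left m₃ hN
    rw [hv, one_div_div] at e₁ e₂ e₃
    simp only [integral_const_mul, ← Finset.mul_sum] at e₁ e₂
    set S := ∑ i, ∫ ξ, psi (centredForm lam σ (x i) (v + σ • ξ)) ∂stdGaussian (Vec d)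
    -- Passing from the posterior to its centre costs twice the truncated quartic form at the
    -- centre, hence at most four times its posterior mean.
    have hdiff : |∑ i, psi (lam * (inner ℝ (x i) v) ^ 2) - S|
        ≤ 4 * ∑ i, ∫ ξ, min 1 (quarticForm lam σ (x i) (v + σ • ξ)) ∂stdGaussian (Vec d) := by
      rw [← Finset.sum_sub_distrib, Finset.mul_sum]
      refine (Finset.abs_sum_le_sum_abs _ _).trans (Finset.sum_le_sum fun i _ => ?_)
      linarith [abs_psi_sub_integral_psi_le lam σ (x i) v, min_one_quarticForm_le lam σ (x i) v]
    rw [one_pow] at e₁ e₂ e₃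
    rw [abs_le] at hdiff ⊢
    constructor <;> linarith

end Concentration

/-! ### Covariance matrices and fourth moments -/

section Matrices

variable {d : ℕ}

theorem opNorm_le_of_abs_quadForm_le {A : Mat d} (hA : A.IsHermitian) {c : ℝ} (hc : 0 ≤ c)
    (h : ∀ v : Vec d, ‖v‖ = 1 → |v.ofLp ⬝ᵥ (A *ᵥ v.ofLp)| ≤ c) : ‖A‖ ≤ c := by
  set T := Matrix.toEuclideanCLM (n := Fin d) (𝕜 := ℝ) A with hT
  have hsymm : (T : Vec d →ₗ[ℝ] Vec d).IsSymmetric :=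
    Matrix.isSymmetric_toEuclideanLin_iff.2 hA
  rw [← Matrix.l2_opNorm_toEuclideanCLM, ← hT, T.norm_eq_iSup_rayleighQuotient hsymm]
  refine ciSup_le fun x => ?_
  rcases eq_or_ne x 0 with rfl | hx
  · simpa [ContinuousLinearMap.rayleighQuotient] using hc
  · have hx' : ‖x‖ ≠ 0 := norm_ne_zero_iff.2 hx
    have h1 := h (‖x‖⁻¹ • x) (by rw [norm_smul, norm_inv, norm_norm, inv_mul_cancel₀ hx'])
    rw [← Matrix.inner_toEuclideanCLM, ← hT, map_smul, real_inner_smul_left,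
      real_inner_smul_right] at h1
    have h2 : T.rayleighQuotient x = ‖x‖⁻¹ * (‖x‖⁻¹ * inner ℝ x (T x)) := by
      change T.reApplyInnerSelf x / ‖x‖ ^ 2 = _
      rw [ContinuousLinearMap.reApplyInnerSelf_apply, real_inner_comm]
      simp only [RCLike.re_to_real]
      field_simp
    rwa [h2]

theorem abs_quadForm_le_opNorm (A : Mat d) {v : Vec d} (hv : ‖v‖ = 1) :
    |v.ofLp ⬝ᵥ (A *ᵥ v.ofLp)| ≤ ‖A‖ := by
  rw [← Matrix.inner_toEuclideanCLM]
  refine (abs_real_inner_le_norm _ _).trans ?_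
  rw [hv, one_mul, ← Matrix.l2_opNorm_toEuclideanCLM]
  simpa [hv] using (Matrix.toEuclideanCLM (n := Fin d) (𝕜 := ℝ) A).le_opNorm v

end Matrices

section Moments

variable {Ω : Type*} [MeasurableSpace Ω] {P : Measure Ω} {d : ℕ}
  {X : Ω → Vec d}

theorem memLp_coord (hX : MemLp X 2 P) (i : Fin d) : MemLp (fun ω => X ω i) 2 P :=
  (EuclideanSpace.proj (𝕜 := ℝ) i).comp_memLp' hX

theorem inner_eq_sum (x v : Vec d) : (inner ℝ x v : ℝ) = ∑ i, x i * v i := by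
  simp [PiLp.inner_apply, mul_comm]

theorem memLp_inner (hX : MemLp X 2 P) (v : Vec d) :
    MemLp (fun ω => (inner ℝ (X ω) v : ℝ)) 2 P := by
  have := (innerSL ℝ v).comp_memLp' hX
  refine this.congr_norm (hX.1.inner_const) (Filter.Eventually.of_forall fun ω => ?_)
  simp [real_inner_comm]

theorem integral_pow_eq_eLpNorm_pow {Y : Ω → ℝ} {n : ℕ} (hn : Even n) (hn0 : n ≠ 0)
    (hY : MemLp Y n P) : ∫ ω, Y ω ^ n ∂P = (eLpNorm Y n P).toReal ^ n := by
  rw [hY.eLpNorm_eq_integral_rpow_norm (by exact_mod_cast hn0) (by simp),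
    ENNReal.toReal_ofReal (by positivity), ENNReal.toReal_natCast, ← rpow_natCast,
    ← rpow_mul (by positivity), inv_mul_cancel₀ (by exact_mod_cast hn0), rpow_one]
  congr 1
  ext ω
  rw [rpow_natCast, Real.norm_eq_abs, hn.pow_abs]

variable {κ : ℝ → ℝ}

theorem memLp_four_inner (hX : MemLp X 2 P) (hκ : NormEquivalence X P 4 κ) (v : Vec d) :
    MemLp (fun ω => (inner ℝ (X ω) v : ℝ)) 4 P := by
  have h := hκ v 4 (by norm_num) le_rfl
  rw [ENNReal.ofReal_ofNat] at h
  exact ⟨(memLp_inner hX v).1, h.trans_lt (ENNReal.mul_lt_top (by simp) (memLp_inner hX v).2)⟩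

/-- The norm equivalence in terms of moments. As only even powers of `κ 4` occur, its sign is
irrelevant. -/
theorem integral_inner_pow_four_le (hX : MemLp X 2 P) (hκ : NormEquivalence X P 4 κ) (v : Vec d) :
    ∫ ω, (inner ℝ (X ω) v : ℝ) ^ 4 ∂P ≤ κ 4 ^ 4 * (∫ ω, (inner ℝ (X ω) v : ℝ) ^ 2 ∂P) ^ 2 := by
  have h := hκ v 4 (by norm_num) le_rfl
  rw [ENNReal.ofReal_ofNat] at h
  have h2 := memLp_inner hX v
  have e4 := integral_pow_eq_eLpNorm_pow (n := 4) (by decide) (by decide) (memLp_four_inner hX hκ v)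
  have e2 := integral_pow_eq_eLpNorm_pow (n := 2) (by decide) (by decide) h2
  simp only [Nat.cast_ofNat] at e4 e2
  rw [e4, e2]
  have h' := ENNReal.toReal_mono (ENNReal.mul_lt_top (by simp) h2.2).ne h
  rw [ENNReal.toReal_mul, ENNReal.toReal_ofReal'] at h'
  calc _ ≤ (max (κ 4) 0 * (eLpNorm (fun ω => (inner ℝ (X ω) v : ℝ)) 2 P).toReal) ^ 4 :=
        pow_le_pow_left₀ ENNReal.toReal_nonneg h' 4
    _ = max (κ 4) 0 ^ 4 * ((eLpNorm (fun ω => (inner ℝ (X ω) v : ℝ)) 2 P).toReal ^ 2) ^ 2 := by ring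
    _ ≤ _ := by
        gcongr ?_ * _
        rcases max_cases (κ 4) 0 with ⟨h, _⟩ | ⟨h, _⟩ <;> rw [h]
        rw [zero_pow (by norm_num)]
        positivity

theorem integrable_norm_pow_four (hX : MemLp X 2 P) (hκ : NormEquivalence X P 4 κ) :
    Integrable (fun ω => ‖X ω‖ ^ 4) P := by
  have hi : ∀ i : Fin d, Integrable (fun ω => X ω i ^ 4) P := fun i => by
    have h := (memLp_four_inner hX hκ (EuclideanSpace.single i 1)).integrable_norm_pow (by norm_num)
    refine h.congr (Filter.Eventually.of_forall fun ω => ?_)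
    simp [Even.pow_abs (by decide : Even 4), EuclideanSpace.inner_single_right]
  refine ((integrable_finsetSum Finset.univ fun i _ => hi i).const_mul (d : ℝ)).mono'
    (hX.1.norm.pow 4) (Filter.Eventually.of_forall fun ω => ?_)
  rw [norm_of_nonneg (by positivity), show ‖X ω‖ ^ 4 = (‖X ω‖ ^ 2) ^ 2 by ring,
    EuclideanSpace.real_norm_sq_eq]
  have h := sq_sum_le_card_mul_sum_sq (s := Finset.univ) (f := fun i => X ω i ^ 2)
  simp only [Finset.card_univ, Fintype.card_fin] at h
  refine h.trans (le_of_eq ?_)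
  congr 1
  refine Finset.sum_congr rfl fun i _ => ?_
  ring

variable [IsProbabilityMeasure P]

theorem covMatrix_apply_of_centred (hX : MemLp X 2 P) (h0 : ∫ ω, X ω ∂P = 0) (i j : Fin d) :
    covMatrix X P i j = ∫ ω, X ω i * X ω j ∂P := by
  have hm : ∀ i, ∫ ω, X ω i ∂P = 0 := fun i => by
    have := (EuclideanSpace.proj (𝕜 := ℝ) i).integral_comp_comm (hX.integrable (by norm_num))
    rw [h0, map_zero] at this
    exact this
  simp [covMatrix, covariance, hm]

theorem quadForm_covMatrix (hX : MemLp X 2 P) (h0 : ∫ ω, X ω ∂P = 0) (v : Vec d) :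
    v.ofLp ⬝ᵥ (covMatrix X P *ᵥ v.ofLp) = ∫ ω, (inner ℝ (X ω) v) ^ 2 ∂P := by
  have hi : ∀ i j, Integrable (fun ω => X ω i * X ω j) P := fun i j =>
    (memLp_coord hX i).integrable_mul (memLp_coord hX j)
  have h1 : ∀ ω, (inner ℝ (X ω) v : ℝ) ^ 2 = ∑ i, ∑ j, v i * v j * (X ω i * X ω j) := by
    intro ω
    rw [inner_eq_sum, sq, Finset.sum_mul_sum]
    refine Finset.sum_congr rfl fun i _ => Finset.sum_congr rfl fun j _ => ?_
    ring
  simp_rw [h1]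
  rw [integral_finsetSum _ fun i _ => integrable_finsetSum _ fun j _ => (hi i j).const_mul _]
  simp only [dotProduct, Matrix.mulVec]
  refine Finset.sum_congr rfl fun i _ => ?_
  rw [integral_finsetSum _ fun j _ => (hi i j).const_mul _, Finset.mul_sum]
  refine Finset.sum_congr rfl fun j _ => ?_
  rw [integral_const_mul, covMatrix_apply_of_centred hX h0]
  ring

theorem trace_covMatrix (hX : MemLp X 2 P) (h0 : ∫ ω, X ω ∂P = 0) :
    (covMatrix X P).trace = ∫ ω, ‖X ω‖ ^ 2 ∂P := by
  have hi : ∀ i j, Integrable (fun ω => X ω i * X ω j) P := fun i j =>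
    (memLp_coord hX i).integrable_mul (memLp_coord hX j)
  simp_rw [EuclideanSpace.real_norm_sq_eq, sq]
  rw [integral_finsetSum _ fun i _ => hi i i]
  exact Finset.sum_congr rfl fun i _ => covMatrix_apply_of_centred hX h0 i i

theorem isHermitian_covMatrix (hX : MemLp X 2 P) (h0 : ∫ ω, X ω ∂P = 0) :
    (covMatrix X P).IsHermitian := by
  ext i j
  rw [Matrix.conjTranspose_apply, star_trivial, covMatrix_apply_of_centred hX h0,
    covMatrix_apply_of_centred hX h0]
  simp_rw [mul_comm]

theorem posSemidef_covMatrix (hX : MemLp X 2 P) (h0 : ∫ ω, X ω ∂P = 0) :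
    (covMatrix X P).PosSemidef := by
  refine Matrix.PosSemidef.of_dotProduct_mulVec_nonneg (isHermitian_covMatrix hX h0) fun v => ?_
  have h := quadForm_covMatrix hX h0 (WithLp.toLp 2 v)
  simp only [star_trivial]
  simp only at h
  rw [h]
  exact integral_nonneg fun ω => sq_nonneg _

theorem norm_covMatrix_le_trace (hX : MemLp X 2 P) (h0 : ∫ ω, X ω ∂P = 0) :
    ‖covMatrix X P‖ ≤ (covMatrix X P).trace := by
  have hn : Integrable (fun ω => ‖X ω‖ ^ 2) P := hX.integrable_norm_pow (by norm_num)
  rw [trace_covMatrix hX h0]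
  refine opNorm_le_of_abs_quadForm_le (isHermitian_covMatrix hX h0)
    (integral_nonneg fun ω => by positivity) fun v hv => ?_
  rw [quadForm_covMatrix hX h0, abs_of_nonneg (integral_nonneg fun ω => sq_nonneg _)]
  refine integral_mono_of_nonneg (Filter.Eventually.of_forall fun ω => sq_nonneg _) hn
    (Filter.Eventually.of_forall fun ω => ?_)
  have := abs_real_inner_le_norm (X ω) v
  rw [hv, mul_one] at this
  exact sq_le_sq.2 (by rwa [abs_norm])

/-- The fourth moment of the norm: expand `‖X‖ ^ 4` in coordinates and apply the Cauchy-Schwarz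
inequality to each `E (X i ^ 2 * X j ^ 2)`. -/
theorem integral_norm_pow_four_le (hX : MemLp X 2 P) (h0 : ∫ ω, X ω ∂P = 0)
    (hκ : NormEquivalence X P 4 κ) :
    ∫ ω, ‖X ω‖ ^ 4 ∂P ≤ κ 4 ^ 4 * (covMatrix X P).trace ^ 2 := by
  have hin : ∀ ω (i : Fin d), (inner ℝ (X ω) (EuclideanSpace.single i 1) : ℝ) = X ω i := by
    intro ω i
    simp [EuclideanSpace.inner_single_right]
  have hsq : ∀ i : Fin d, MemLp (fun ω => X ω i ^ 2) 2 P := fun i => by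
    have h := memLp_four_inner hX hκ (EuclideanSpace.single i 1)
    simp only [hin] at h
    refine (memLp_two_iff_integrable_sq (h.1.pow 2)).2 ?_
    refine (h.integrable_norm_pow (by norm_num)).congr (Filter.Eventually.of_forall fun ω => ?_)
    simp only [Real.norm_eq_abs]
    rw [Even.pow_abs (by decide), Pi.pow_apply, ← pow_mul]
  set a : Fin d → ℝ := fun i => ∫ ω, X ω i ^ 2 ∂P with ha
  have ha0 : ∀ i, 0 ≤ a i := fun i => integral_nonneg fun ω => sq_nonneg _
  have h4 : ∀ i, ∫ ω, (X ω i ^ 2) ^ (2 : ℝ) ∂P ≤ (κ 4 ^ 2 * a i) ^ (2 : ℝ) := fun i => by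
    have h := integral_inner_pow_four_le hX hκ (EuclideanSpace.single i 1)
    simp only [hin] at h
    simp only [rpow_two, ← pow_mul]
    calc _ ≤ _ := h
      _ = _ := by ring
  have hij : ∀ i j, ∫ ω, X ω i ^ 2 * X ω j ^ 2 ∂P ≤ κ 4 ^ 4 * (a i * a j) := fun i j => by
    have hr : ∀ i, (∫ ω, (X ω i ^ 2) ^ (2 : ℝ) ∂P) ^ (1 / (2 : ℝ)) ≤ κ 4 ^ 2 * a i := fun i => by
      have hnn : 0 ≤ κ 4 ^ 2 * a i := mul_nonneg (sq_nonneg _) (ha0 i)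
      calc _ ≤ ((κ 4 ^ 2 * a i) ^ (2 : ℝ)) ^ (1 / (2 : ℝ)) := by
            refine rpow_le_rpow (integral_nonneg fun ω => ?_) (h4 i) (by norm_num)
            positivity
        _ = _ := by
            rw [← rpow_mul hnn]
            norm_num
    have h := integral_mul_le_Lp_mul_Lq_of_nonneg (μ := P) (Real.HolderConjugate.two_two)
      (f := fun ω => X ω i ^ 2) (g := fun ω => X ω j ^ 2)
      (Filter.Eventually.of_forall fun ω => sq_nonneg _)
      (Filter.Eventually.of_forall fun ω => sq_nonneg _)
      (by simpa using hsq i) (by simpa using hsq j)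
    calc _ ≤ _ := h
      _ ≤ (κ 4 ^ 2 * a i) * (κ 4 ^ 2 * a j) := by
          refine mul_le_mul (hr i) (hr j) ?_ (mul_nonneg (sq_nonneg _) (ha0 i))
          refine rpow_nonneg (integral_nonneg fun ω => ?_) _
          positivity
      _ = _ := by ring
  have hi : ∀ i j, Integrable (fun ω => X ω i ^ 2 * X ω j ^ 2) P := fun i j =>
    (hsq i).integrable_mul (hsq j)
  have htr : (covMatrix X P).trace = ∑ i, a i := by
    refine Finset.sum_congr rfl fun i _ => ?_
    rw [Matrix.diag_apply, covMatrix_apply_of_centred hX h0]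
    simp only [ha, sq]
  have hexp : ∀ ω, ‖X ω‖ ^ 4 = ∑ i, ∑ j, X ω i ^ 2 * X ω j ^ 2 := fun ω => by
    rw [show ‖X ω‖ ^ 4 = (‖X ω‖ ^ 2) ^ 2 by ring, EuclideanSpace.real_norm_sq_eq, sq,
      Finset.sum_mul_sum]
  simp_rw [hexp]
  rw [integral_finsetSum _ fun i _ => integrable_finsetSum _ fun j _ => hi i j, htr, sq,
    Finset.sum_mul_sum, Finset.mul_sum]
  refine Finset.sum_le_sum fun i _ => ?_
  rw [integral_finsetSum _ fun j _ => hi i j, Finset.mul_sum]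
  exact Finset.sum_le_sum fun j _ => hij i j

/-- If `κ 4 = 0`, all fourth moments of `⟨X, v⟩` vanish, hence so does the covariance matrix. -/
theorem kappa_ne_zero (hX : MemLp X 2 P) (h0 : ∫ ω, X ω ∂P = 0)
    (hκ : NormEquivalence X P 4 κ) (hs : 0 < ‖covMatrix X P‖) : κ 4 ≠ 0 := by
  intro hk
  refine hs.not_ge (opNorm_le_of_abs_quadForm_le (isHermitian_covMatrix hX h0) le_rfl fun v _ => ?_)
  rw [quadForm_covMatrix hX h0]
  have h4 := integral_inner_pow_four_le hX hκ v
  rw [hk] at h4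
  have hm4 : Integrable (fun ω => (inner ℝ (X ω) v : ℝ) ^ 4) P := by
    refine ((memLp_four_inner hX hκ v).integrable_norm_pow (by norm_num)).congr
      (Filter.Eventually.of_forall fun ω => ?_)
    simp only [Real.norm_eq_abs]
    rw [Even.pow_abs (by decide)]
  have hz : ∫ ω, (inner ℝ (X ω) v : ℝ) ^ 4 ∂P = 0 :=
    le_antisymm (by simpa using h4) (integral_nonneg fun ω => by positivity)
  rw [integral_eq_zero_iff_of_nonneg (fun ω => by positivity) hm4] at hz
  have hz2 : ∫ ω, (inner ℝ (X ω) v : ℝ) ^ 2 ∂P = 0 := by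
    refine integral_eq_zero_of_ae (hz.mono fun ω hω => ?_)
    simp only [Pi.zero_apply, pow_eq_zero_iff, ne_eq, OfNat.ofNat_ne_zero, not_false_eq_true]
      at hω ⊢
    exact hω
  rw [hz2, abs_zero]

end Moments

/-! ### The estimator -/

theorem exists_isTruncEstimator {d N : ℕ} (C η δ k t s : ℝ) :
    ∃ est : (Fin N → Vec d) → Mat d, IsTruncEstimator C η δ k t s est := by
  classical
  refine ⟨fun x => if h : (feasibleSet C η δ k t s x).Nonempty then h.some else 0, fun x => ?_⟩
  refine ⟨fun h => ?_, fun h => ?_⟩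
  · simp only [dif_pos h]
    exact h.some_mem
  · simp only [h, Set.not_nonempty_empty, dif_neg, not_false_eq_true]

/-- Any two feasible matrices have close quadratic forms on the unit sphere, hence are close. -/
theorem norm_sub_le_of_mem_feasibleSet {d N : ℕ} {C η δ k t s : ℝ} {x : Fin N → Vec d} {A B : Mat d}
    (hc : 0 ≤ C * truncLevel N η δ k t s * k ^ 4 * s ^ 2)
    (hA : A ∈ feasibleSet C η δ k t s x) (hB : B ∈ feasibleSet C η δ k t s x) :
    ‖A - B‖ ≤ C * truncLevel N η δ k t s * k ^ 4 * s ^ 2 := by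
  refine opNorm_le_of_abs_quadForm_le (hA.1.isHermitian.sub hB.1.isHermitian) hc fun v hv => ?_
  have h1 := abs_le.1 (hA.2 v hv)
  have h2 := abs_le.1 (hB.2 v hv)
  rw [Matrix.sub_mulVec, dotProduct_sub, abs_le]
  constructor <;> linarith [h1.1, h1.2, h2.1, h2.2]

/-- Replacing a point changes the truncated sum by at most `1`, as `ψ` maps `[0, ∞)` to `[0, 1]`. -/
theorem abs_sum_psi_sub_sum_psi_le {d N : ℕ} {lam : ℝ} (hlam : 0 ≤ lam) (x y : Fin N → Vec d)
    (v : Vec d) :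
    |∑ i, psi (lam * (inner ℝ (x i) v) ^ 2) - ∑ i, psi (lam * (inner ℝ (y i) v) ^ 2)|
      ≤ (Nat.card {i : Fin N // x i ≠ y i} : ℝ) := by
  classical
  have hψ : ∀ z : Vec d, 0 ≤ psi (lam * (inner ℝ z v) ^ 2) ∧ psi (lam * (inner ℝ z v) ^ 2) ≤ 1 :=
    fun z => ⟨psi_nonneg (by positivity), (le_abs_self _).trans (abs_psi_le_one _)⟩
  rw [← Finset.sum_sub_distrib]
  calc _ ≤ ∑ i, |psi (lam * (inner ℝ (x i) v) ^ 2) - psi (lam * (inner ℝ (y i) v) ^ 2)| :=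
        Finset.abs_sum_le_sum_abs _ _
    _ ≤ ∑ i, if x i ≠ y i then (1 : ℝ) else 0 := by
        refine Finset.sum_le_sum fun i _ => ?_
        split_ifs with h
        · rw [abs_le]
          constructor <;> linarith [(hψ (x i)).1, (hψ (x i)).2, (hψ (y i)).1, (hψ (y i)).2]
        · rw [not_not.1 h, sub_self, abs_zero]
    _ = _ := by
        rw [Finset.sum_boole, Nat.card_eq_fintype_card, Fintype.card_subtype]

theorem map_sample_eq_pi {Ω : Type*} [MeasurableSpace Ω] {P : Measure Ω} [IsProbabilityMeasure P]
    {d N : ℕ} {X₀ : Ω → Vec d} {X : Fin N → Ω → Vec d} (hX : IsSample X X₀ P) :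
    P.map (fun ω i => X i ω) = Measure.pi fun _ : Fin N => P.map X₀ := by
  rw [(iIndepFun_iff_map_fun_eq_pi_map fun i => (hX.copies i).aemeasurable_fst).1 hX.indep]
  simp_rw [fun i => (hX.copies i).map_eq]

theorem log_three_div_le {δ : ℝ} (hδ : 0 < δ) : log (3 / δ) ≤ 2 + log (1 / δ) := by
  rw [div_eq_mul_one_div, log_mul (by norm_num) (by positivity)]
  have := log_le_sub_one_of_pos (show (0 : ℝ) < 3 by norm_num)
  linarith

section Scaling

variable {N : ℕ} {η δ k t s : ℝ}

/-- `λ ^ 2 k ^ 4 s ^ 2` is the squared rate: this is what the choice of the truncation level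
achieves. -/
theorem truncLevel_sq_mul (hk : k ≠ 0) (hs : s ≠ 0)
    (hL : 0 ≤ effRank t s + log (1 / δ) + η * N) :
    truncLevel N η δ k t s ^ 2 * (k ^ 4 * s ^ 2) = (effRank t s + log (1 / δ) + η * N) / N := by
  rw [truncLevel, mul_pow, sq_sqrt (by positivity)]
  field_simp

theorem truncLevel_mul_pow_le (hN : 0 < N) (hk : k ≠ 0) (hs : 0 < s) (hη : 0 ≤ η)
    (hr : 0 ≤ effRank t s + log (1 / δ)) {C : ℝ} (hC : 0 ≤ C) :
    C * truncLevel N η δ k t s * k ^ 4 * s ^ 2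
      ≤ C * k ^ 2 * s * (√((effRank t s + log (1 / δ)) / N) + √η) := by
  have hN' : (N : ℝ) ≠ 0 := by positivity
  have h1 : √((effRank t s + log (1 / δ) + η * N) / N)
      ≤ √((effRank t s + log (1 / δ)) / N) + √η := by
    rw [add_div, mul_div_cancel_right₀ _ hN']
    exact Real.sqrt_le_iff.2 ⟨by positivity, by
      nlinarith [sq_sqrt (show 0 ≤ (effRank t s + log (1 / δ)) / N by positivity), sq_sqrt hη,
        mul_nonneg (sqrt_nonneg ((effRank t s + log (1 / δ)) / N)) (sqrt_nonneg η)]⟩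
  calc _ = C * k ^ 2 * s * √((effRank t s + log (1 / δ) + η * N) / N) := by
        rw [truncLevel]
        field_simp
    _ ≤ _ := by gcongr

end Scaling

section Main

variable {Ω : Type*} [MeasurableSpace Ω] {P : Measure Ω} [IsProbabilityMeasure P] {d N : ℕ}
  {X₀ : Ω → Vec d} {κ : ℝ → ℝ} {X X' : Fin N → Ω → Vec d} {η δ : ℝ}

/-- Uniform concentration for the uncorrupted sample, at the truncation level `λ`. With posterior
variance `s / t`, the inverse of the effective rank, all contributions are of the same order. -/
theorem measure_truncated_sum_le (hN : 0 < N) (hη : 0 ≤ η) (hδ : 0 < δ) (hδ1 : δ < 1)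
    (hX₀ : MemLp X₀ 2 P) (h0 : ∫ ω, X₀ ω ∂P = 0) (hκ : NormEquivalence X₀ P 4 κ)
    {t s : ℝ} (ht : (covMatrix X₀ P).trace = t) (hs : ‖covMatrix X₀ P‖ = s) (hs0 : 0 < s)
    (hX : IsSample X X₀ P) :
    ∃ B : Set Ω, P B ≤ ENNReal.ofReal δ ∧ ∀ ω ∉ B, ∀ v : Vec d, ‖v‖ = 1 →
      |∑ i, psi (truncLevel N η δ (κ 4) t s * (inner ℝ (X i ω) v) ^ 2)
        - N * (truncLevel N η δ (κ 4) t s * (v.ofLp ⬝ᵥ (covMatrix X₀ P *ᵥ v.ofLp)))|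
      ≤ 4135 * (effRank t s + log (1 / δ) + η * N) := by
  have hk : κ 4 ≠ 0 := kappa_ne_zero hX₀ h0 hκ (hs ▸ hs0)
  have hst : s ≤ t := by
    rw [← hs, ← ht]
    exact norm_covMatrix_le_trace hX₀ h0
  have ht0 : 0 < t := hs0.trans_le hst
  have hr : 1 ≤ effRank t s := (one_le_div hs0).2 hst
  have hlog : 0 ≤ log (1 / δ) := log_nonneg (by rw [le_div_iff₀ hδ]; linarith)
  set L := effRank t s + log (1 / δ) + η * N with hL
  have hηN : 0 ≤ η * N := by positivity
  have hL1 : 0 ≤ L := by linarith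
  set lam := truncLevel N η δ (κ 4) t s with hlam
  have hlamsq : N * (lam ^ 2 * (κ 4 ^ 4 * s ^ 2)) = L := by
    rw [hlam, truncLevel_sq_mul hk hs0.ne' hL1, mul_div_cancel₀ _ (by positivity)]
  have hX₀m : AEMeasurable X₀ P := hX₀.1.aemeasurable
  have : IsProbabilityMeasure (P.map X₀) := Measure.isProbabilityMeasure_map hX₀m
  have hmap : ∀ f : Vec d → ℝ, Continuous f → ∫ x, f x ∂(P.map X₀) = ∫ ω, f (X₀ ω) ∂P :=
    fun f hf => integral_map hX₀m hf.aestronglyMeasurable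
  have h4 : Integrable (fun x => ‖x‖ ^ 4) (P.map X₀) := by
    rw [integrable_map_measure (by fun_prop) hX₀m]
    exact integrable_norm_pow_four hX₀ hκ
  have hσ2 : √(s / t) ^ 2 = s / t := sq_sqrt (by positivity)
  obtain ⟨B, hBm, hB, hBx⟩ := exists_sum_psi_sub_le h4 N (lam := lam) (σ := √(s / t))
    (M := κ 4 ^ 4 * s ^ 2) (δ := δ) (by positivity) hδ
    (fun v hv => by
      rw [hmap _ (by fun_prop)]
      refine (integral_inner_pow_four_le hX₀ hκ v).trans ?_
      have hq := abs_quadForm_le_opNorm (covMatrix X₀ P) hv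
      rw [quadForm_covMatrix hX₀ h0, hs] at hq
      gcongr
      exact (le_abs_self _).trans hq)
    (by
      rw [hmap _ (by fun_prop), show √(s / t) ^ 4 = (√(s / t) ^ 2) ^ 2 by ring, hσ2]
      calc (s / t) ^ 2 * ∫ ω, ‖X₀ ω‖ ^ 4 ∂P ≤ (s / t) ^ 2 * (κ 4 ^ 4 * t ^ 2) := by
            rw [← ht]
            gcongr
            exact integral_norm_pow_four_le hX₀ h0 hκ
        _ = _ := by field_simp)
  have hXm : AEMeasurable (fun ω i => X i ω) P :=
    aemeasurable_pi_lambda _ fun i => (hX.copies i).aemeasurable_fst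
  refine ⟨(fun ω i => X i ω) ⁻¹' B, ?_, fun ω hω v hv => ?_⟩
  · rw [← Measure.map_apply_of_aemeasurable hXm hBm, map_sample_eq_pi hX]
    exact hB
  · have h := hBx _ hω v hv
    rw [hmap _ (by fun_prop), ← quadForm_covMatrix hX₀ h0, hlamsq, hσ2] at h
    -- `1 / (2 σ²) + log (3 / δ) ≤ r / 2 + 2 r + log (1 / δ) ≤ 3 L` as `r ≥ 1`, and
    -- `5 * (824 + 3) = 4135`.
    have hr2 : 1 / (2 * (s / t)) = effRank t s / 2 := by
      rw [effRank]
      field_simp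
    rw [hr2] at h
    refine h.trans ?_
    linarith [log_three_div_le hδ]

/-- The covariance matrix is feasible for the corrupted sample: the corruption adds `η N`, at most
one further `effRank t s + log (1 / δ) + η N`, to the deviation, and `8272 = 2 * (4135 + 1)`. -/
theorem covMatrix_mem_feasibleSet {t s k : ℝ} {Sig : Mat d} (hN : 0 < N) (hk : k ≠ 0)
    (hs : 0 < s) (hη : 0 ≤ η) (hr : 0 < effRank t s + log (1 / δ)) (hSig : Sig.PosSemidef)
    {x x' : Fin N → Vec d} (hx : (Nat.card {i : Fin N // x' i ≠ x i} : ℝ) ≤ η * N)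
    (h : ∀ v : Vec d, ‖v‖ = 1 →
      |∑ i, psi (truncLevel N η δ k t s * (inner ℝ (x i) v) ^ 2)
        - N * (truncLevel N η δ k t s * (v.ofLp ⬝ᵥ (Sig *ᵥ v.ofLp)))|
      ≤ 4135 * (effRank t s + log (1 / δ) + η * N)) :
    Sig ∈ feasibleSet 8272 η δ k t s x' := by
  refine ⟨hSig, fun v hv => ?_⟩
  have hN' : (0 : ℝ) < N := by exact_mod_cast hN
  have hηN : 0 ≤ η * N := by positivity
  have hL : 0 < effRank t s + log (1 / δ) + η * N := by linarith
  have hsq := truncLevel_sq_mul (N := N) hk hs.ne' hL.le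
  have hlam : 0 < truncLevel N η δ k t s := by
    unfold truncLevel
    positivity
  have h1 := h v hv
  have h2 := abs_sum_psi_sub_sum_psi_le hlam.le x' x v
  set lam := truncLevel N η δ k t s
  set L := effRank t s + log (1 / δ) + η * N
  set Q := v.ofLp ⬝ᵥ (Sig *ᵥ v.ofLp)
  have h3 : |∑ i, psi (lam * (inner ℝ (x' i) v) ^ 2) - N * (lam * Q)| ≤ 4136 * L := by
    have hηL : η * N ≤ L := by linarith
    rw [abs_le] at *
    constructor <;> linarith
  have h4 : truncForm lam x' v - Q
      = (1 / (lam * N)) * (∑ i, psi (lam * (inner ℝ (x' i) v) ^ 2) - N * (lam * Q)) := by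
    unfold truncForm
    field_simp
  rw [h4, abs_mul, abs_of_pos (by positivity)]
  calc _ ≤ 1 / (lam * N) * (4136 * L) := by gcongr
    _ = 4136 * (L / N) / lam := by field_simp
    _ = _ := by
        rw [← hsq]
        field_simp
        ring

end Main

end RobustCov

theorem mainTheorem3 :
    ∃ C : ℝ, 0 < C ∧
      ∀ (d N : ℕ), 0 < N →
      ∀ (η δ : ℝ), 0 ≤ η → η ≤ 1 → 0 < δ → δ < 1 →
      ∀ (k t s : ℝ),
        (∃ est : (Fin N → RobustCov.Vec d) → RobustCov.Mat d,
          RobustCov.IsTruncEstimator C η δ k t s est) ∧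
        ∀ est : (Fin N → RobustCov.Vec d) → RobustCov.Mat d,
          RobustCov.IsTruncEstimator C η δ k t s est →
          ∀ (Ω : Type*) [MeasurableSpace Ω] (P : Measure Ω) [IsProbabilityMeasure P]
            (X₀ : Ω → RobustCov.Vec d) (κ : ℝ → ℝ) (X X' : Fin N → Ω → RobustCov.Vec d),
            MemLp X₀ 2 P →
            ∫ ω, X₀ ω ∂P = 0 →
            RobustCov.NormEquivalence X₀ P 4 κ →
            κ 4 = k →
            (RobustCov.covMatrix X₀ P).trace = t →
            ‖RobustCov.covMatrix X₀ P‖ = s →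
            RobustCov.IsSample X X₀ P →
            RobustCov.IsCorrupted η X' X P →
            P {ω | ¬ ‖est (fun i => X' i ω) - RobustCov.covMatrix X₀ P‖
                ≤ C * k ^ 2 * s * (√((RobustCov.effRank t s + Real.log (1 / δ)) / N) + √η)}
              ≤ ENNReal.ofReal δ := by
  refine ⟨8272, by norm_num, fun d N hN η δ hη _ hδ hδ1 k t s =>
    ⟨RobustCov.exists_isTruncEstimator _ _ _ _ _ _, ?_⟩⟩
  intro est hest Ω _ P _ X₀ κ X X' hX₀ h0 hκ hk ht hs hX hX'
  subst hk
  rcases (hs ▸ norm_nonneg _ : 0 ≤ s).eq_or_lt with hs0 | hs0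
  · -- For `s = 0` the truncation level is `1 / 0 = 0`, so that `0` is feasible and all feasible
    -- matrices vanish.
    have hcov : RobustCov.covMatrix X₀ P = 0 := norm_eq_zero.1 (hs.trans hs0.symm)
    have hbad : {ω | ¬ ‖est (fun i => X' i ω) - RobustCov.covMatrix X₀ P‖
        ≤ 8272 * κ 4 ^ 2 * s * (√((RobustCov.effRank t s + Real.log (1 / δ)) / N) + √η)} = ∅ := by
      refine Set.eq_empty_of_forall_notMem fun ω hω => hω ?_
      have hzero : (0 : RobustCov.Mat d)
          ∈ RobustCov.feasibleSet 8272 η δ (κ 4) t s (fun i => X' i ω) := by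
        refine ⟨Matrix.PosSemidef.zero, fun v _ => ?_⟩
        simp [← hs0, RobustCov.truncLevel, RobustCov.truncForm]
      have hmem := (hest fun i => X' i ω).1 ⟨0, hzero⟩
      have h := RobustCov.norm_sub_le_of_mem_feasibleSet (by simp [← hs0]) hmem hzero
      rw [hcov]
      simpa [← hs0] using h
    rw [hbad, measure_empty]
    exact zero_le
  · have hk : κ 4 ≠ 0 := RobustCov.kappa_ne_zero hX₀ h0 hκ (hs ▸ hs0)
    have hst : s ≤ t := by
      rw [← hs, ← ht]
      exact RobustCov.norm_covMatrix_le_trace hX₀ h0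
    have hr : 1 ≤ RobustCov.effRank t s := (one_le_div hs0).2 hst
    have hlog : 0 ≤ Real.log (1 / δ) := Real.log_nonneg (by rw [le_div_iff₀ hδ]; linarith)
    obtain ⟨B, hB, hBω⟩ :=
      RobustCov.measure_truncated_sum_le hN hη hδ hδ1 hX₀ h0 hκ ht hs hs0 hX
    refine (measure_mono_ae ?_).trans hB
    filter_upwards [hX'] with ω hω hbad
    by_contra hωB
    refine hbad ?_
    have hfeas := RobustCov.covMatrix_mem_feasibleSet hN hk hs0 hη (by linarith)
      (RobustCov.posSemidef_covMatrix hX₀ h0) hω (hBω ω hωB)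
    have hmem := (hest fun i => X' i ω).1 ⟨_, hfeas⟩
    refine (RobustCov.norm_sub_le_of_mem_feasibleSet ?_ hmem hfeas).trans
      (RobustCov.truncLevel_mul_pow_le hN hk hs0 hη (by linarith) (by norm_num))
    unfold RobustCov.truncLevel
    positivity
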